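/- Let $G$ be a finite connected graph, possibly with loops and parallel edges, and let $S\subseteq E(G)$ be a 5-configuration, i.e. $|S|=5$. Orient the edges of $G$ arbitrarily, let $\hat\xi$ be the signed $E(G)\times V(G)$ incidence matrix with the column of one arbitrary vertex deleted, let $A$ be the diagonal matrix with entries the variables $x_e$ ($e\in E(G)$), and put $$M_G=\begin{pmatrix}A&\hat\xi\\-\hat\xi^{T}&0\end{pmatrix}.$$ For $I,J,K\subseteq E(G)$ with $|I|=|J|$ let the Dodgson polynomial $\Psi^{I,J}_K$ (well defined up to sign) be the determinant of the matrix obtained from $M_G$ by deleting the rows indexed by $I$ and the columns indexed by $J$ and setting $x_e=0$ for all $e\in K$. Say that $S$ splits if $\Psi^{I,J}_K$ is identically zero for some $I,J,K$ with $I\cup J\cup K=S$, $I\cap K=J\cap K=\emptyset$ and either $|I|=|J|=2$, $|K|=1$, $I\cap J=\emptyset$, or $|I|=|J|=3$, $K=\emptyset$, $|I\cap J|=1$. Then $S$ splits if and only if there is an edge $e\in S$ such that, with $G'$ equal to one of $G\setminus e$ or $G/e$, there exist edge-disjoint subgraphs $G_1,G_2$ of $G'$ with $G'=G_1\cup G_2$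 satisfying one of the following: 1. $|V(G_1)\cap V(G_2)|\le 2$ and $|E(G_1)\cap S|=2$; 2. $|V(G_1)\cap V(G_2)|=1$ and $|E(G_1)\cap S|=1$. (Contracting a loop means deleting it.) -/

import Mathlib

open scoped Graph

namespace FeynmanSplit

variable {α β : Type*}

/-- A graph is connected if it has a vertex and any two of its vertices are joined by a walk. -/
def Connected (G : Graph α β) : Prop :=
  V(G).Nonempty ∧ ∀ x ∈ V(G), ∀ y ∈ V(G), Relation.ReflTransGen G.Adj x y

/-- The deletion `G \ e`. -/
def delete (G : Graph α β) (e : β) : Graph α β := G.deleteEdges {e}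

/-- The contraction `G / e`: remove `e` and identify its two ends (so that contracting a loop is
the same as deleting it). -/
def contract (G : Graph α β) (e : β) : Graph (Quot (G.IsLink e)) β :=
  (G.deleteEdges {e}).map (Quot.mk (G.IsLink e))

/-- A choice of direction for every edge of `G`. -/
structure Orientation (G : Graph α β) where
  tail : E(G) → V(G)
  head : E(G) → V(G)
  isLink : ∀ e : E(G), G.IsLink (e : β) (tail e : α) (head e : α)

theorem Orientation.exists (G : Graph α β) : Nonempty (Orientation G) := by
  choose x y h using fun e : E(G) => G.exists_isLink_of_mem_edgeSet e.2
  exact ⟨⟨fun e => ⟨x e, (h e).left_mem⟩, fun e => ⟨y e, (h e).right_mem⟩, h⟩⟩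

open Classical in
/-- The signed incidence matrix of an oriented graph with the column of the vertex `r` removed.
A loop has a zero row. -/
noncomputable def reducedIncidence {G : Graph α β} (o : Orientation G) (r : V(G)) :
    Matrix E(G) {v : V(G) // v ≠ r} (MvPolynomial E(G) ℤ) :=
  fun e v => (if o.head e = v.1 then 1 else 0) - (if o.tail e = v.1 then 1 else 0)

open Classical in
/-- The matrix `[A, ξ; -ξᵀ, 0]`, where `ξ` is the reduced incidence matrix and `A` is the diagonal
matrix of the edge variables, with the variables of the edges in `K` set to zero. -/
noncomputable def kirchhoffMatrix {G : Graph α β} (o : Orientation G) (r : V(G)) (K : Set β) :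
    Matrix (E(G) ⊕ {v : V(G) // v ≠ r}) (E(G) ⊕ {v : V(G) // v ≠ r}) (MvPolynomial E(G) ℤ) :=
  Matrix.fromBlocks
    (Matrix.diagonal fun e : E(G) => if (e : β) ∈ K then 0 else MvPolynomial.X e)
    (reducedIncidence o r) (-(reducedIncidence o r).transpose) 0

/-- The rows (or columns) that remain when those indexed by the edges in `I` are deleted. -/
abbrev Remaining {G : Graph α β} (r : V(G)) (I : Set β) : Type _ :=
  {e : E(G) // (e : β) ∉ I} ⊕ {v : V(G) // v ≠ r}

/-- The inclusion of the remaining indices into all indices. -/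
def Remaining.incl {G : Graph α β} (r : V(G)) (I : Set β) :
    Remaining r I → E(G) ⊕ {v : V(G) // v ≠ r} :=
  Sum.map Subtype.val id

open Classical in
/-- The Dodgson polynomial `Ψ^{I,J}_K`: the determinant of the matrix obtained by deleting the rows
in `I` and the columns in `J` and setting the variables of `K` to zero.  To take the determinant,
the remaining rows have to be matched with the remaining columns, by the bijection `σ`; another
choice of `σ` changes the polynomial at most by a sign (see `dodgson_eq_or_eq_neg`). -/
noncomputable def dodgson {G : Graph α β} [Finite V(G)] [Finite E(G)]
    (o : Orientation G) (r : V(G)) (I J K : Set β) (σ : Remaining r I ≃ Remaining r J) :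
    MvPolynomial E(G) ℤ :=
  letI : Fintype (Remaining r I) := Fintype.ofFinite _
  ((kirchhoffMatrix o r K).submatrix (Remaining.incl r I)
    (fun i => Remaining.incl r J (σ i))).det

theorem dodgson_eq_or_eq_neg {G : Graph α β} [Finite V(G)] [Finite E(G)]
    (o : Orientation G) (r : V(G)) (I J K : Set β) (σ τ : Remaining r I ≃ Remaining r J) :
    dodgson o r I J K σ = dodgson o r I J K τ ∨
      dodgson o r I J K σ = -dodgson o r I J K τ := by
  classical
  letI : Fintype (Remaining r I) := Fintype.ofFinite _
  have key := Matrix.det_permute' (σ.trans τ.symm)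
    ((kirchhoffMatrix o r K).submatrix (Remaining.incl r I) (fun i => Remaining.incl r J (τ i)))
  have h : dodgson o r I J K σ
      = ((Equiv.Perm.sign (σ.trans τ.symm) : ℤ) : MvPolynomial E(G) ℤ)
        * dodgson o r I J K τ := by
    unfold dodgson
    convert key using 2
    ext i j
    simp
  rcases Int.units_eq_one_or (Equiv.Perm.sign (σ.trans τ.symm)) with hs | hs
  · left; simpa [hs] using h
  · right; simpa [hs] using h

/-- A `5`-configuration of `G`: a set of five edges. -/
def IsFiveConfiguration (G : Graph α β) (S : Set β) : Prop :=
  S ⊆ E(G) ∧ S.encard = 5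

/-- The index triples `(I, J, K)` of the thirty (up to exchanging `I` and `J`) Dodgson polynomials
associated to the `5`-configuration `S`. -/
def IsDodgsonIndex (S I J K : Set β) : Prop :=
  I ∪ J ∪ K = S ∧ Disjoint I K ∧ Disjoint J K ∧
    ((I.encard = 2 ∧ J.encard = 2 ∧ K.encard = 1 ∧ Disjoint I J) ∨
     (I.encard = 3 ∧ J.encard = 3 ∧ K = ∅ ∧ (I ∩ J).encard = 1))

/-- `S` splits if at least one of its associated Dodgson polynomials is identically zero.  These
polynomials are formed, up to sign, with the orientation `o` and the removed vertex `r`. -/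
def Splits {G : Graph α β} [Finite V(G)] [Finite E(G)] (o : Orientation G) (r : V(G))
    (S : Set β) : Prop :=
  ∃ I J K : Set β, IsDodgsonIndex S I J K ∧
    ∃ σ : Remaining r I ≃ Remaining r J, dodgson o r I J K σ = 0

/-- `G` is the union of its edge-disjoint subgraphs `G₁` and `G₂`. -/
def IsDecomposition (G G₁ G₂ : Graph α β) : Prop :=
  G₁ ≤ G ∧ G₂ ≤ G ∧ V(G₁) ∪ V(G₂) = V(G) ∧ E(G₁) ∪ E(G₂) = E(G) ∧ Disjoint E(G₁) E(G₂)

/-- `G` has an edge-disjoint decomposition into two parts which either meet in at most two vertices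
with exactly two edges of `S` in the first part, or meet in exactly one vertex with exactly one
edge of `S` in the first part. -/
def HasSplittingDecomposition (G : Graph α β) (S : Set β) : Prop :=
  ∃ G₁ G₂ : Graph α β, IsDecomposition G G₁ G₂ ∧
    (((V(G₁) ∩ V(G₂)).encard ≤ 2 ∧ (E(G₁) ∩ S).encard = 2) ∨
     ((V(G₁) ∩ V(G₂)).encard = 1 ∧ (E(G₁) ∩ S).encard = 1))

end FeynmanSplit

/-! The vanishing of a Dodgson polynomial says that certain common spanning trees do not exist, and
matroid intersection turns this absence into a small separation.

The determinant is affine in each variable outside `S`. Hence it is nonzero exactly when some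
choice, for each such edge, of either the coefficient of `x_e` (the edge is deleted) or the value at
`x_e = 0` (the edge is kept) leaves a nonzero minor. The kernel of that minor decouples into a flow
and a potential, and it is trivial if and only if the set `T` of kept edges completes both `(J \ I)
∪ K` and `(I \ J) ∪ K` to spanning trees (`dodgson_ne_zero_iff`). If `K = {k}`, then `k` lies in
both trees and is in effect contracted; if `I ∩ J = {k}`, then `k` lies in neither and is deleted.
The other four edges fall into two pairs `A` and `B` (`splits_iff_lacksCommonTree`).

For independent `A` and `B`, such a `T` is a common basis of the graphic matroid contracted by `A`
and by `B`. If there is none, matroid intersection gives a set `X` of edges containing `A` and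
missing `B` such that the ranks of `X` and of its complement add up to at most `|V|`. The components
of the two sets then overlap so little that merging them leaves two or three pieces, from which a
separation is read off (`separated_of_rank_add_rank_le`, `IsBlobFamily.separated`). Conversely, a
separation leaves too few vertices for the edges of the two trees
(`Separated.exists_forall_not_isTree`). Bridges and loops in `S` break these arguments and are
treated by hand in `lacksCommonTree_iff`. -/

namespace FeynmanSplit

/-! ### Matroid rank functions and matroid intersection. -/

/-- The axioms of the rank function of a matroid. -/
structure IsRank {α : Type*} [DecidableEq α] (r : Finset α → ℤ) : Prop where
  empty : r ∅ = 0
  mono : ∀ ⦃X Y⦄, X ⊆ Y → r X ≤ r Y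
  singleton_le : ∀ e, r {e} ≤ 1
  submod : ∀ X Y, r (X ∪ Y) + r (X ∩ Y) ≤ r X + r Y

namespace IsRank

variable {α : Type*} [DecidableEq α] {r r₁ r₂ : Finset α → ℤ}

theorem nonneg (h : IsRank r) (X : Finset α) : 0 ≤ r X :=
  h.empty ▸ h.mono (Finset.empty_subset X)

theorem union_le (h : IsRank r) (X Y : Finset α) : r (X ∪ Y) ≤ r X + r Y := by
  have := h.submod X Y
  have := h.nonneg (X ∩ Y)
  linarith

theorem le_card (h : IsRank r) (X : Finset α) : r X ≤ X.card := by
  induction X using Finset.induction_on with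
  | empty => simp [h.empty]
  | insert e X he ih =>
    rw [Finset.card_insert_of_notMem he, Finset.insert_eq]
    have := h.union_le {e} X
    have := h.singleton_le e
    push_cast
    linarith

/-- The rank function of a contraction. -/
theorem contract (h : IsRank r) (Z : Finset α) : IsRank fun X => r (X ∪ Z) - r Z where
  empty := by simp
  mono X Y hXY := by
    have := h.mono (Finset.union_subset_union_left (t := Z) hXY)
    linarith
  singleton_le e := by
    have := h.union_le {e} Z
    have := h.singleton_le e
    linarith
  submod X Y := by
    have := h.submod (X ∪ Z) (Y ∪ Z)
    rw [← Finset.union_union_distrib_right, ← Finset.inter_union_distrib_right] at this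
    linarith

/-- Matroid intersection. -/
theorem exists_common_independent (h₁ : IsRank r₁) (h₂ : IsRank r₂) (F : Finset α) (n : ℕ)
    (hn : ∀ X ⊆ F, (n : ℤ) ≤ r₁ X + r₂ (F \ X)) :
    ∃ T ⊆ F, T.card = n ∧ r₁ T = n ∧ r₂ T = n := by
  induction F using Finset.induction_on generalizing r₁ r₂ n with
  | empty =>
    have := hn ∅ (Finset.Subset.refl _)
    have h0 : n = 0 := by
      simp only [h₁.empty, Finset.sdiff_self, h₂.empty] at this
      omega
    exact ⟨∅, Finset.Subset.refl _, by simp [h0], by simp [h0, h₁.empty], by simp [h0, h₂.empty]⟩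
  | insert e F he ih =>
    -- If the bound survives the deletion of `e`, then `e` is not needed. Otherwise the violating
    -- set `A` allows `e` to be contracted and put into `T`.
    by_cases hdel : ∀ X ⊆ F, (n : ℤ) ≤ r₁ X + r₂ (F \ X)
    · obtain ⟨T, hT, h⟩ := ih h₁ h₂ n hdel
      exact ⟨T, hT.trans (Finset.subset_insert _ _), h⟩
    push Not at hdel
    obtain ⟨A, hA, hlt⟩ := hdel
    have sd1 : ∀ X ⊆ F, insert e F \ insert e X = F \ X := by
      intro X hX; ext x; simp only [Finset.mem_sdiff, Finset.mem_insert]; grind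
    have sd2 : ∀ X ⊆ F, insert e F \ X = insert e (F \ X) := by
      intro X hX; ext x; simp only [Finset.mem_sdiff, Finset.mem_insert]; grind
    have hA1 := hn (insert e A) (Finset.insert_subset_insert _ hA)
    have hA2 := hn A (hA.trans (Finset.subset_insert _ _))
    rw [sd1 A hA] at hA1
    rw [sd2 A hA] at hA2
    rw [Finset.insert_eq] at hA1 hA2
    have e1 := h₁.union_le {e} A
    have e2 := h₂.union_le {e} (F \ A)
    have f1 := h₁.singleton_le e
    have f2 := h₂.singleton_le e
    -- Adding `e` to either side of the splitting `(A, F \ A)` restores the bound, so `e` is a loop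
    -- of neither matroid.
    have g1 : r₁ {e} = 1 := by omega
    have g2 : r₂ {e} = 1 := by omega
    obtain ⟨m, rfl⟩ : ∃ m, n = m + 1 := by
      refine ⟨n - 1, ?_⟩
      have := h₁.nonneg A
      have := h₂.nonneg (F \ A)
      omega
    obtain ⟨T, hT, hc, i1, i2⟩ := ih (h₁.contract {e}) (h₂.contract {e}) m (by
      intro C hC
      -- Uncrossing: the unions and intersections of `A` with `C ∪ {e}` give two splittings of
      -- `insert e F`, each worth at least `m + 1`, while `A` accounts for at most `m`. So `C`
      -- accounts for at least `m + 2`, and contracting `e` costs 2.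
      have s1 := h₁.submod A (C ∪ {e})
      have s2 := h₂.submod (F \ A) (F \ C ∪ {e})
      have eA : e ∉ A := fun h => he (hA h)
      have u1 := hn (A ∪ (C ∪ {e})) (by
        intro x; have := @hA x; have := @hC x; simp only [Finset.mem_union,
          Finset.mem_singleton, Finset.mem_insert]; tauto)
      have u2 := hn (A ∩ (C ∪ {e})) (by
        intro x; have := @hA x; simp only [Finset.mem_inter, Finset.mem_insert]; tauto)
      have v1 : insert e F \ (A ∪ (C ∪ {e})) = (F \ A) ∩ (F \ C ∪ {e}) := by
        ext x; simp only [Finset.mem_sdiff, Finset.mem_insert, Finset.mem_union,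
          Finset.mem_inter, Finset.mem_singleton]; grind
      have v2 : insert e F \ (A ∩ (C ∪ {e})) = (F \ A) ∪ (F \ C ∪ {e}) := by
        ext x; simp only [Finset.mem_sdiff, Finset.mem_insert, Finset.mem_union,
          Finset.mem_inter, Finset.mem_singleton]; grind
      rw [v1] at u1
      rw [v2] at u2
      push_cast at hlt u1 u2
      linarith)
    have heT : e ∉ T := fun h => he (hT h)
    refine ⟨insert e T, Finset.insert_subset_insert _ hT, ?_, ?_, ?_⟩
    · rw [Finset.card_insert_of_notMem heT, hc]
    · rw [Finset.insert_eq, Finset.union_comm]; push_cast; linarith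
    · rw [Finset.insert_eq, Finset.union_comm]; push_cast; linarith

end IsRank

/-! ### The graphic matroid, described by potentials. -/

section Rank

open Module

variable {V E : Type*} (t h : E → V)

/-- The rational functions on the vertices which agree at the two ends of each edge of `X`. -/
def potentials (X : Finset E) : Submodule ℚ (V → ℚ) where
  carrier := {f | ∀ e ∈ X, f (t e) = f (h e)}
  add_mem' hf hg e he := by simp [hf e he, hg e he]
  zero_mem' _ _ := rfl
  smul_mem' c f hf e he := by simp [hf e he]

/-- The edges of `X` connect all vertices. -/
def Spans (X : Finset E) : Prop := ∀ f ∈ potentials t h X, ∀ u v, f u = f v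

variable {t h}

theorem mem_potentials {X : Finset E} {f : V → ℚ} :
    f ∈ potentials t h X ↔ ∀ e ∈ X, f (t e) = f (h e) := Iff.rfl

theorem potentials_anti {X Y : Finset E} (hXY : X ⊆ Y) : potentials t h Y ≤ potentials t h X :=
  fun _ hf e he => hf e (hXY he)

variable (t h) in
/-- The rank of a set of edges in the graphic matroid. -/
noncomputable def rank [Fintype V] (X : Finset E) : ℤ :=
  Fintype.card V - finrank ℚ (potentials t h X)

variable [Fintype V]

theorem rank_le_of_potentials_le {E' : Type*} {t' h' : E' → V} {X : Finset E} {Y : Finset E'}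
    (hle : potentials t' h' Y ≤ potentials t h X) : rank t h X ≤ rank t' h' Y := by
  have := Submodule.finrank_mono hle
  unfold rank
  omega

theorem rank_mono {X Y : Finset E} (hXY : X ⊆ Y) : rank t h X ≤ rank t h Y :=
  rank_le_of_potentials_le (potentials_anti hXY)

/-- Submodularity is the dimension formula: the potentials of a union are the intersection of the
two spaces, and those of an intersection contain their sum. -/
theorem isRank_rank [DecidableEq E] : IsRank (rank t h) where
  empty := by
    have : potentials t h (∅ : Finset E) = ⊤ := by
      ext f; simp [mem_potentials]
    rw [rank, this, finrank_top]
    simp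
  mono _ _ := rank_mono
  singleton_le e := by
    let φ : (V → ℚ) →ₗ[ℚ] ℚ := LinearMap.proj (R := ℚ) (φ := fun _ : V => ℚ) (t e) -
      LinearMap.proj (R := ℚ) (φ := fun _ : V => ℚ) (h e)
    have : potentials t h {e} = LinearMap.ker φ := by
      ext f; simp [φ, mem_potentials, sub_eq_zero]
    have h1 := LinearMap.finrank_range_add_finrank_ker φ
    have h2 := Submodule.finrank_le (LinearMap.range φ)
    rw [← this] at h1
    rw [finrank_fintype_fun_eq_card] at h1
    rw [finrank_self] at h2
    unfold rank
    omega
  submod X Y := by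
    have h1 := Submodule.finrank_sup_add_finrank_inf_eq (potentials t h X) (potentials t h Y)
    have h2 : potentials t h (X ∪ Y) = potentials t h X ⊓ potentials t h Y := by
      ext f
      simp only [mem_potentials, Submodule.mem_inf, Finset.mem_union]
      exact ⟨fun H => ⟨fun e he => H e (.inl he), fun e he => H e (.inr he)⟩,
        fun H e he => he.elim (H.1 e) (H.2 e)⟩
    have h3 := Submodule.finrank_mono (sup_le (potentials_anti (t := t) (h := h)
      (Finset.inter_subset_left (s₁ := X) (s₂ := Y))) (potentials_anti Finset.inter_subset_right))
    unfold rank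
    rw [h2]
    omega

theorem Spans.rank_eq [Nonempty V] {X : Finset E} (hX : Spans t h X) :
    rank t h X = Fintype.card V - 1 := by
  have : potentials t h X = Submodule.span ℚ {fun _ => 1} := by
    ext f
    rw [Submodule.mem_span_singleton]
    constructor
    · intro hf
      refine ⟨f (Classical.arbitrary V), ?_⟩
      ext v
      simp [hX f hf v (Classical.arbitrary V)]
    · rintro ⟨c, rfl⟩ e _
      simp
  rw [rank, this, finrank_span_singleton]
  · simp
  · intro h0
    simpa using congrFun h0 (Classical.arbitrary V)

theorem spans_of_le_rank {X : Finset E} (hX : (Fintype.card V : ℤ) - 1 ≤ rank t h X) :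
    Spans t h X := by
  have h1 : finrank ℚ (potentials t h X) ≤ 1 := by unfold rank at hX; omega
  rw [finrank_le_one_iff] at h1
  obtain ⟨⟨g, hg⟩, h1⟩ := h1
  obtain ⟨c, hc⟩ := h1 ⟨fun _ => 1, fun _ _ => rfl⟩
  have hc' : ∀ v, c * g v = 1 := fun v => congrFun (congrArg Subtype.val hc) v
  intro f hf u v
  obtain ⟨d, hd⟩ := h1 ⟨f, hf⟩
  have hd' : ∀ v, d * g v = f v := fun v => congrFun (congrArg Subtype.val hd) v
  have h0 : c ≠ 0 := by
    rintro rfl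
    simpa using hc' u
  have : g u = g v := mul_left_cancel₀ h0 ((hc' u).trans (hc' v).symm)
  rw [← hd', ← hd', this]

theorem rank_lt_of_separates {X Y : Finset E} (hXY : X ⊆ Y) {f : V → ℚ}
    (hf : f ∈ potentials t h X) (hY : f ∉ potentials t h Y) : rank t h X < rank t h Y := by
  have : potentials t h Y < potentials t h X :=
    lt_of_le_of_ne (potentials_anti hXY) fun H => hY (H ▸ hf)
  have := Submodule.finrank_lt_finrank_of_lt this
  unfold rank
  omega

/-- The star on `U` centred at `u` has `#U - 1` edges, and its potentials are constant on `U`, so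
they are also potentials of `X`. -/
theorem rank_le_card_sub_one {X : Finset E} {U : Finset V} (hU : U.Nonempty)
    (hX : ∀ e ∈ X, t e ∈ U ∧ h e ∈ U) : rank t h X ≤ U.card - 1 := by
  classical
  obtain ⟨u, hu⟩ := hU
  have h1 : rank t h X ≤ rank (fun _ : V => u) id (U.erase u) := by
    apply rank_le_of_potentials_le
    have key : ∀ f ∈ potentials (fun _ : V => u) id (U.erase u), ∀ v ∈ U, f u = f v := by
      intro f hf v hv
      by_cases hvu : v = u
      · rw [hvu]
      · exact hf v (Finset.mem_erase.2 ⟨hvu, hv⟩)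
    intro f hf e he
    rw [← key f hf _ (hX e he).1, ← key f hf _ (hX e he).2]
  have h2 := (isRank_rank (t := fun _ : V => u) (h := id)).le_card (U.erase u)
  have h3 := Finset.card_erase_add_one hu
  omega

/-- Each new edge raises the rank because an explicit function respects the earlier edges and
separates its ends: the indicator of both ends of `a` if `b` touches `a`, else that of one end of
`b`. -/
theorem two_le_rank_pair [DecidableEq E] {a b : E} (ha : t a ≠ h a) (hb : t b ≠ h b)
    (hab : ¬ ((t b = t a ∨ t b = h a) ∧ (h b = t a ∨ h b = h a))) :
    2 ≤ rank t h {a, b} := by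
  classical
  have h0 : rank t h ∅ < rank t h {a} := by
    refine rank_lt_of_separates (by simp) (f := Pi.single (t a) 1) (by simp [mem_potentials]) ?_
    simp [mem_potentials, ha.symm, Pi.single_apply]
  have h1 : rank t h {a} < rank t h {a, b} := by
    by_cases hb' : (t b = t a ∨ t b = h a) ∨ (h b = t a ∨ h b = h a)
    · refine rank_lt_of_separates (by simp)
        (f := fun v => if v = t a ∨ v = h a then 1 else 0) (by simp [mem_potentials]) ?_
      simp only [mem_potentials, Finset.mem_insert, Finset.mem_singleton, forall_eq_or_imp,
        forall_eq, not_and]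
      intro _
      by_cases h1 : t b = t a ∨ t b = h a <;> by_cases h2 : h b = t a ∨ h b = h a <;>
        simp_all
    · push Not at hb'
      refine rank_lt_of_separates (by simp) (f := Pi.single (t b) 1) ?_ ?_
      · simp [mem_potentials, Pi.single_apply, hb'.1.1.symm, hb'.1.2.symm]
      · simp [mem_potentials, Pi.single_apply, hb.symm]
  have := (isRank_rank (t := t) (h := h)).empty
  omega

end Rank

/-! ### Separations and families of overlapping vertex sets. -/

open Finset in
/-- The edges in `D` can be divided into two parts which either have at most two common vertices
with exactly two edges of `S` in the first part, or have exactly one common vertex with exactly one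
edge of `S` in the first part. -/
def Separated {V E : Type*} [Fintype V] [DecidableEq V] [DecidableEq E] (t h : E → V)
    (D S : Finset E) : Prop :=
  ∃ (X : Finset E) (U₁ U₂ : Finset V), X ⊆ D ∧ U₁ ∪ U₂ = univ ∧
    (∀ e ∈ X, t e ∈ U₁ ∧ h e ∈ U₁) ∧ (∀ e ∈ D, e ∉ X → t e ∈ U₂ ∧ h e ∈ U₂) ∧
    ((#(U₁ ∩ U₂) ≤ 2 ∧ #(X ∩ S) = 2) ∨ (#(U₁ ∩ U₂) = 1 ∧ #(X ∩ S) = 1))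

open Finset in
/-- A family of vertex sets `U i`, `i ∈ I`, such that each edge `e` in `D` has both ends in the
member `U (p e)`, each member carries at most two edges of `S`, and the family overlaps so little
that its incidence graph has at most one cycle. -/
structure IsBlobFamily {V E ι : Type*} [Fintype V] [DecidableEq ι] (t h : E → V) (D S : Finset E)
    (I : Finset ι) (U : ι → Finset V) (p : E → ι) : Prop where
  mem : ∀ e ∈ D, p e ∈ I
  ends : ∀ e ∈ D, t e ∈ U (p e) ∧ h e ∈ U (p e)
  nonempty : ∀ i ∈ I, (U i).Nonempty
  cover : ∀ v, ∃ i ∈ I, v ∈ U i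
  excess : ∑ i ∈ I, #(U i) ≤ Fintype.card V + #I
  small : ∀ i ∈ I, #{e ∈ S | p e = i} ≤ 2

namespace IsBlobFamily

open Finset

variable {V E ι : Type*} [Fintype V] [DecidableEq V] [DecidableEq ι] {t h : E → V}
  {D S : Finset E} {I : Finset ι} {U : ι → Finset V} {p : E → ι}

/-- Otherwise the indicator of the union over `A` would be a nonconstant potential. -/
theorem exists_meet (H : IsBlobFamily t h D S I U p) (hD : Spans t h D) {A : Finset ι}
    (hAI : A ⊂ I) (hA : A.Nonempty) : ∃ i ∈ A, ∃ j ∈ I, j ∉ A ∧ (U i ∩ U j).Nonempty := by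
  by_contra! hcon
  obtain ⟨i, hi⟩ := hA
  obtain ⟨hAI', j, hj, hjA⟩ := Finset.ssubset_iff_exists_subset_erase.1 hAI |>.elim
    fun j hj => (⟨hAI.1, j, hj.1, fun h => by simpa using hj.2 h⟩ : A ⊆ I ∧ ∃ j ∈ I, j ∉ A)
  have key : ∀ k ∈ I, ∀ v ∈ U k, v ∈ A.biUnion U ↔ k ∈ A := by
    intro k hk v hv
    refine ⟨fun hvA => ?_, fun hkA => mem_biUnion.2 ⟨k, hkA, hv⟩⟩
    obtain ⟨l, hl, hvl⟩ := mem_biUnion.1 hvA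
    by_contra hkA
    have := hcon l hl k hk hkA
    exact notMem_empty v (this ▸ mem_inter.2 ⟨hvl, hv⟩)
  obtain ⟨u, hu⟩ := H.nonempty i (hAI' hi)
  obtain ⟨v, hv⟩ := H.nonempty j hj
  have := hD (fun w => if w ∈ A.biUnion U then 1 else 0) (by
    intro e he
    have h1 := key _ (H.mem e he) _ (H.ends e he).1
    have h2 := key _ (H.mem e he) _ (H.ends e he).2
    simp only [h1, h2]) u v
  simp only [key i (hAI' hi) u hu, hi, key j hj v hv, hjA] at this
  norm_num at this

/-- The excess bound survives since the union saves at least one common vertex while the index set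
loses one member. -/
theorem merge (H : IsBlobFamily t h D S I U p) {i j : ι} (hi : i ∈ I) (hj : j ∈ I) (hij : i ≠ j)
    (hU : (U i ∩ U j).Nonempty) (hs : #{e ∈ S | p e = i} + #{e ∈ S | p e = j} ≤ 2) :
    IsBlobFamily t h D S (I.erase j) (Function.update U i (U i ∪ U j))
      (fun e => if p e = j then i else p e) where
  mem e he := by
    have := H.mem e he
    by_cases hp : p e = j <;> simp [hp, hij, hi, this]
  ends e he := by
    have := H.ends e he
    by_cases hp : p e = j
    · simp only [hp, if_true, Function.update_self, mem_union] at this ⊢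
      exact ⟨.inr this.1, .inr this.2⟩
    · simp only [hp, if_false]
      by_cases hp' : p e = i
      · simp only [hp', Function.update_self, mem_union] at this ⊢
        exact ⟨.inl this.1, .inl this.2⟩
      · rwa [Function.update_of_ne hp']
  nonempty k hk := by
    by_cases hki : k = i
    · subst hki
      rw [Function.update_self]
      exact (H.nonempty _ hi).mono subset_union_left
    · rw [Function.update_of_ne hki]
      exact H.nonempty k (mem_of_mem_erase hk)
  cover v := by
    obtain ⟨k, hk, hv⟩ := H.cover v
    by_cases hki : k = i ∨ k = j
    · refine ⟨i, mem_erase.2 ⟨hij, hi⟩, ?_⟩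
      rw [Function.update_self, mem_union]
      rcases hki with rfl | rfl
      · exact .inl hv
      · exact .inr hv
    · push Not at hki
      exact ⟨k, mem_erase.2 ⟨hki.2, hk⟩, by rwa [Function.update_of_ne hki.1]⟩
  excess := by
    have hij' : i ∈ I.erase j := mem_erase.2 ⟨hij, hi⟩
    have h1 := H.excess
    rw [← add_sum_erase _ _ hj, ← add_sum_erase _ _ hij'] at h1
    rw [← add_sum_erase _ _ hij', Function.update_self,
      sum_congr rfl (g := fun k => #(U k)) (fun k hk => by
        rw [Function.update_of_ne (ne_of_mem_erase hk)])]
    have h2 := card_union_add_card_inter (U i) (U j)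
    have h3 := card_pos.2 hU
    have h4 := card_erase_add_one hj
    omega
  small k hk := by
    by_cases hki : k = i
    · classical
      subst hki
      refine le_trans ?_ hs
      refine le_trans (card_le_card (t := {e ∈ S | p e = k} ∪ {e ∈ S | p e = j}) ?_)
        (card_union_le _ _)
      intro e
      simp only [mem_filter, mem_union]
      split_ifs <;> tauto
    · refine le_trans (card_le_card ?_) (H.small k (mem_of_mem_erase hk))
      intro e
      simp only [mem_filter]
      split_ifs with hp
      · intro hh; exact absurd hh.2.symm hki
      · exact id

/-- Meeting members are merged while their edges of `S` number at most two. At the end meeting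
members carry at least three such edges together and at most two each, and every member meets
another one. So every member carries at least one and some member carries two; as the total is four,
the distribution is `2, 2` or `2, 1, 1`. -/
theorem separated [DecidableEq E] (H : IsBlobFamily t h D S I U p) (hD : Spans t h D)
    (hSD : S ⊆ D) (hS : #S = 4) : Separated t h D S := by
  induction hm : #I using Nat.strong_induction_on generalizing I U p with
  | _ m ih =>
  subst hm
  by_cases hmerge : ∃ i ∈ I, ∃ j ∈ I, i ≠ j ∧ (U i ∩ U j).Nonempty ∧
      #{e ∈ S | p e = i} + #{e ∈ S | p e = j} ≤ 2
  · obtain ⟨i, hi, j, hj, hij, hU, hs⟩ := hmerge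
    exact ih _ (card_erase_lt_of_mem hj) (H.merge hi hj hij hU hs) rfl
  push Not at hmerge
  have hsum : ∑ i ∈ I, #{e ∈ S | p e = i} = 4 := by
    rw [← hS]
    exact (card_eq_sum_card_fiberwise fun e he => H.mem e (hSD he)).symm
  have hX : ∀ i, (D.filter fun e => p e = i) ∩ S = S.filter fun e => p e = i := by
    intro i; ext e
    simp only [mem_inter, mem_filter]
    have := @hSD e
    tauto
  have meet : ∀ i ∈ I, ∃ j ∈ I, j ≠ i ∧ (U i ∩ U j).Nonempty := by
    intro i hi
    have hne : ({i} : Finset ι) ≠ I := by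
      rintro rfl
      rw [sum_singleton] at hsum
      have := H.small i hi
      omega
    obtain ⟨i', hi', j, hj, hji, hU⟩ := H.exists_meet hD
      (lt_of_le_of_ne (singleton_subset_iff.2 hi) hne) (singleton_nonempty i)
    rw [mem_singleton] at hi' hji
    subst hi'
    exact ⟨j, hj, hji, hU⟩
  have pos : ∀ i ∈ I, 1 ≤ #{e ∈ S | p e = i} := by
    intro i hi
    obtain ⟨j, hj, hji, hU⟩ := meet i hi
    have := hmerge i hi j hj hji.symm hU
    have := H.small j hj
    omega
  obtain ⟨i, hi, hi2⟩ : ∃ i ∈ I, #{e ∈ S | p e = i} = 2 := by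
    obtain ⟨i, hi⟩ : I.Nonempty := by
      rw [nonempty_iff_ne_empty]; rintro rfl; simp at hsum
    obtain ⟨j, hj, hji, hU⟩ := meet i hi
    have := hmerge i hi j hj hji.symm hU
    have := H.small j hj
    have := H.small i hi
    by_cases h2 : #{e ∈ S | p e = i} = 2
    · exact ⟨i, hi, h2⟩
    · exact ⟨j, hj, by omega⟩
  have hrest := hsum
  rw [← add_sum_erase _ _ hi, hi2] at hrest
  have hcard : #(I.erase i) ≤ 2 := by
    have := card_nsmul_le_sum (I.erase i) (fun i => #{e ∈ S | p e = i}) 1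
      fun k hk => pos k (mem_of_mem_erase hk)
    simp only [smul_eq_mul, mul_one] at this
    omega
  have hex := H.excess
  rw [← add_sum_erase _ _ hi, ← card_erase_add_one hi] at hex
  have hfin : ∀ i ∈ I, ∀ U' : Finset V, (∀ j ∈ I, j ≠ i → U j ⊆ U') → (U i ∪ U' = univ) →
      ((#(U i ∩ U') ≤ 2 ∧ #{e ∈ S | p e = i} = 2) ∨
        (#(U i ∩ U') = 1 ∧ #{e ∈ S | p e = i} = 1)) → Separated t h D S := by
    intro i hi U' hU' huniv hcase
    refine ⟨D.filter fun e => p e = i, U i, U', filter_subset _ _, huniv, ?_, ?_, ?_⟩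
    · intro e he
      rw [mem_filter] at he
      have := H.ends e he.1
      rwa [he.2] at this
    · intro e he hne
      have hpe : p e ≠ i := fun hp => hne (mem_filter.2 ⟨he, hp⟩)
      have := H.ends e he
      exact ⟨hU' _ (H.mem e he) hpe this.1, hU' _ (H.mem e he) hpe this.2⟩
    · rwa [hX]
  have hcov : ∀ W : Finset V, (∀ j ∈ I, U j ⊆ W) → W = univ := by
    intro W hW
    refine eq_univ_of_forall fun v => ?_
    obtain ⟨k, hk, hv⟩ := H.cover v
    exact hW k hk hv
  obtain hc | hc | hc : #(I.erase i) = 0 ∨ #(I.erase i) = 1 ∨ #(I.erase i) = 2 := by omega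
  · rw [card_eq_zero] at hc
    rw [hc] at hrest
    simp at hrest
  · obtain ⟨j, hj⟩ := card_eq_one.1 hc
    have hIj : ∀ k ∈ I, k ≠ i → k = j := fun k hk hki =>
      mem_singleton.1 (hj ▸ mem_erase.2 ⟨hki, hk⟩)
    have huniv : U i ∪ U j = univ := hcov _ fun k hk => by
      by_cases hki : k = i
      · rw [hki]; exact subset_union_left
      · rw [hIj k hk hki]; exact subset_union_right
    rw [hj, sum_singleton, card_singleton] at hex
    have h1 := card_union_add_card_inter (U i) (U j)
    rw [huniv, card_univ] at h1
    exact hfin i hi (U j) (fun k hk hki => by rw [hIj k hk hki]) huniv (.inl ⟨by omega, hi2⟩)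
  · obtain ⟨j, k, hjk, hjk'⟩ := card_eq_two.1 hc
    have hI : ∀ l ∈ I, l = i ∨ l = j ∨ l = k := by
      intro l hl
      by_cases hli : l = i
      · exact .inl hli
      · have : l ∈ I.erase i := mem_erase.2 ⟨hli, hl⟩
        rw [hjk'] at this
        simpa [hli] using this
    have hj : j ∈ I.erase i := by simp [hjk']
    have hk : k ∈ I.erase i := by simp [hjk']
    rw [mem_erase] at hj hk
    rw [hjk', sum_pair hjk] at hrest hex
    rw [card_pair hjk] at hex
    have pj := pos j hj.2
    have pk := pos k hk.2
    have hdis : U j ∩ U k = ∅ := by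
      by_contra hne
      have := hmerge j hj.2 k hk.2 hjk (nonempty_iff_ne_empty.2 hne)
      omega
    have mj : (U j ∩ U i).Nonempty := by
      obtain ⟨l, hl, hlj, hU⟩ := meet j hj.2
      rcases hI l hl with rfl | rfl | rfl
      · exact hU
      · exact absurd rfl hlj
      · rw [hdis] at hU; simp at hU
    have mk : (U k ∩ U i).Nonempty := by
      obtain ⟨l, hl, hlj, hU⟩ := meet k hk.2
      rcases hI l hl with rfl | rfl | rfl
      · exact hU
      · rw [inter_comm, hdis] at hU; simp at hU
      · exact absurd rfl hlj
    have c1 := card_union_add_card_inter (U i) (U j ∪ U k)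
    have c2 := card_union_add_card_inter (U j) (U k)
    have huniv : U i ∪ (U j ∪ U k) = univ := hcov _ fun l hl => by
      rcases hI l hl with rfl | rfl | rfl
      · exact subset_union_left
      · exact subset_union_left.trans subset_union_right
      · exact subset_union_right.trans subset_union_right
    have c3 : #(U i ∩ (U j ∪ U k)) = #(U j ∩ U i) + #(U k ∩ U i) := by
      rw [inter_comm, union_inter_distrib_right, card_union_of_disjoint]
      rw [disjoint_iff_inter_eq_empty, ← inter_inter_distrib_right, hdis, empty_inter]
    rw [huniv, card_univ, c3] at c1
    rw [hdis, card_empty] at c2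
    have p1 := card_pos.2 mj
    have p2 := card_pos.2 mk
    -- By the excess bound the overlaps of `U i` with `U j` and `U k` total at most 3, and both are
    -- positive, so one of them is a single vertex.
    by_cases hone : #(U j ∩ U i) = 1
    · refine hfin j hj.2 (U i ∪ U k) ?_ ?_ (.inr ⟨?_, by omega⟩)
      · intro l hl hlj
        rcases hI l hl with rfl | rfl | rfl
        · exact subset_union_left
        · exact absurd rfl hlj
        · exact subset_union_right
      · rw [← huniv, union_left_comm]
      · rw [inter_union_distrib_left, hdis, union_empty, hone]
    · refine hfin k hk.2 (U i ∪ U j) ?_ ?_ (.inr ⟨?_, by omega⟩)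
      · intro l hl hlj
        rcases hI l hl with rfl | rfl | rfl
        · exact subset_union_left
        · exact subset_union_right
        · exact absurd rfl hlj
      · rw [← huniv, union_left_comm, union_comm (U k)]
      · rw [inter_union_distrib_left, inter_comm (U k) (U j), hdis, union_empty]
        omega

end IsBlobFamily

/-! ### Connected components of an edge set and of its complement. -/

section Components

open Finset Module

universe u

variable {V : Type u} {E : Type*} [Fintype V] {t h : E → V}

/-- Vertices are identified when all potentials agree on them, so every potential factors through
the quotient. This bounds the number of components from below, which is the direction that the
excess bound requires. -/
theorem exists_components (X : Finset E) :
    ∃ (Q : Type u) (_ : Fintype Q) (π : V → Q), Function.Surjective π ∧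
      (∀ e ∈ X, π (t e) = π (h e)) ∧ finrank ℚ (potentials t h X) ≤ Fintype.card Q := by
  classical
  let s : Setoid V := ⟨fun u v => ∀ f ∈ potentials t h X, f u = f v,
    ⟨fun _ _ _ => rfl, fun h f hf => (h f hf).symm, fun h h' f hf => (h f hf).trans (h' f hf)⟩⟩
  refine ⟨Quotient s, Fintype.ofFinite _, Quotient.mk s, Quotient.mk_surjective, ?_, ?_⟩
  · intro e he
    exact Quotient.sound fun f hf => hf e he
  · let _ : Fintype (Quotient s) := Fintype.ofFinite _
    have : potentials t h X ≤ LinearMap.range (LinearMap.funLeft ℚ ℚ (Quotient.mk s)) := by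
      intro f hf
      exact ⟨fun q => Quotient.lift f
        (fun u v (huv : ∀ g ∈ potentials t h X, g u = g v) => huv f hf) q, rfl⟩
    refine (Submodule.finrank_mono this).trans ((LinearMap.finrank_range_le _).trans ?_)
    rw [finrank_fintype_fun_eq_card]

variable [DecidableEq V] [DecidableEq E]

/-- The family consists of the components of `X` and of `D \ X`, isolated vertices included. Their
sizes sum to `2|V|`, and the rank bound says that there are at least `|V|` of them, which is the
excess bound. -/
theorem separated_of_rank_add_rank_le {D S X : Finset E} (hD : Spans t h D) (hSD : S ⊆ D)
    (hS : #S = 4) (hr : rank t h X + rank t h (D \ X) ≤ Fintype.card V)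
    (h₁ : #(S ∩ X) ≤ 2) (h₂ : #(S \ X) ≤ 2) : Separated t h D S := by
  classical
  obtain ⟨Q₁, _, π₁, s₁, e₁, r₁⟩ := exists_components (t := t) (h := h) X
  obtain ⟨Q₂, _, π₂, s₂, e₂, r₂⟩ := exists_components (t := t) (h := h) (D \ X)
  refine IsBlobFamily.separated (ι := Q₁ ⊕ Q₂) (I := univ)
    (U := Sum.elim (fun q => univ.filter fun v => π₁ v = q) fun q => univ.filter fun v => π₂ v = q)
    (p := fun e => if e ∈ X then .inl (π₁ (t e)) else .inr (π₂ (t e)))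
    ⟨fun _ _ => mem_univ _, ?_, ?_, ?_, ?_, ?_⟩ hD hSD hS
  · intro e he
    by_cases hX : e ∈ X
    · simp [hX, e₁ e hX]
    · simp [hX, e₂ e (mem_sdiff.2 ⟨he, hX⟩)]
  · rintro (q | q) _
    · obtain ⟨v, rfl⟩ := s₁ q
      exact ⟨v, by simp⟩
    · obtain ⟨v, rfl⟩ := s₂ q
      exact ⟨v, by simp⟩
  · intro v
    exact ⟨.inl (π₁ v), mem_univ _, by simp⟩
  · rw [Fintype.sum_sum_type]
    simp only [Sum.elim_inl, Sum.elim_inr]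
    have c₁ := card_eq_sum_card_fiberwise (s := (univ : Finset V)) (t := univ) (f := π₁)
      fun _ _ => by simp
    have c₂ := card_eq_sum_card_fiberwise (s := (univ : Finset V)) (t := univ) (f := π₂)
      fun _ _ => by simp
    rw [← c₁, ← c₂, card_univ, card_univ, Fintype.card_sum]
    unfold rank at hr
    omega
  · rintro (q | q) _
    · refine (card_le_card ?_).trans h₁
      intro e
      by_cases hX : e ∈ X <;> simp +contextual [hX]
    · refine (card_le_card ?_).trans h₂
      intro e
      by_cases hX : e ∈ X <;> simp +contextual [hX]

end Components

open Finset

/-! ### Spanning trees versus separations. -/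

section SpanningTrees

variable {V E : Type*} [Fintype V] {t h : E → V}

variable (t h) in
/-- `T` is the edge set of a spanning tree. -/
def IsTree (T : Finset E) : Prop := Spans t h T ∧ #T + 1 = Fintype.card V

variable [DecidableEq E]

theorem IsTree.card_add_one_le {T Y : Finset E} (hT : IsTree t h T) (hY : Y ⊆ T)
    {U : Finset V} (hU : U.Nonempty) (hYU : ∀ e ∈ Y, t e ∈ U ∧ h e ∈ U) : #Y + 1 ≤ #U := by
  have : Nonempty V := ⟨hU.choose⟩
  have h1 := hT.1.rank_eq
  have h2 := hT.2
  have h3 := (isRank_rank (t := t) (h := h)).union_le Y (T \ Y)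
  rw [union_sdiff_of_subset hY] at h3
  have h4 := rank_le_card_sub_one hU hYU
  have h5 := (isRank_rank (t := t) (h := h)).le_card (T \ Y)
  have h6 := card_sdiff_add_card_eq_card hY
  omega

variable [DecidableEq V]

theorem separated_of_loop {D S : Finset E} {k : E} (hk : t k = h k) (hkS : k ∈ S) (hkD : k ∈ D) :
    Separated t h D S := by
  refine ⟨{k}, {t k}, univ, by simpa, by simp, by simp [hk], by simp, .inr ⟨by simp, ?_⟩⟩
  rw [inter_eq_left.2 (by simpa), card_singleton]

theorem separated_of_rank_lt_two {D S A : Finset E} (hSD : S ⊆ D) (hAS : A ⊆ S) (hA : #A = 2)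
    (hr : rank t h A < 2) : Separated t h D S := by
  obtain ⟨a, b, hab, rfl⟩ := card_eq_two.1 hA
  have ha := hAS (mem_insert_self a _)
  have hb := hAS (mem_insert_of_mem (mem_singleton_self b))
  by_cases la : t a = h a
  · exact separated_of_loop la ha (hSD ha)
  by_cases lb : t b = h b
  · exact separated_of_loop lb hb (hSD hb)
  have hpar : (t b = t a ∨ t b = h a) ∧ (h b = t a ∨ h b = h a) := by
    by_contra hn
    have := two_le_rank_pair la lb hn
    omega
  refine ⟨{a, b}, {t a, h a}, univ, hAS.trans hSD, by simp, ?_, by simp, .inl ⟨?_, ?_⟩⟩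
  · simpa using hpar
  · rw [inter_univ]; exact card_le_two
  · rw [inter_eq_left.2 hAS, hA]

/-- If no set `T` of edges outside `S` completes both pairs `A` and `B` of edges in `S` to spanning
trees, then `S` is separated. -/
theorem separated_of_forall_not_isTree {F A B : Finset E} (hA : #A = 2) (hB : #B = 2)
    (hAB : Disjoint A B) (hF : Disjoint F (A ∪ B)) (hD : Spans t h (F ∪ (A ∪ B)))
    (hT : ∀ T ⊆ F, ¬ (IsTree t h (T ∪ A) ∧ IsTree t h (T ∪ B))) :
    Separated t h (F ∪ (A ∪ B)) (A ∪ B) := by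
  by_cases rA : rank t h A < 2
  · exact separated_of_rank_lt_two subset_union_right subset_union_left hA rA
  by_cases rB : rank t h B < 2
  · exact separated_of_rank_lt_two subset_union_right subset_union_right hB rB
  have R := isRank_rank (t := t) (h := h)
  have lA := R.le_card A
  have lB := R.le_card B
  have hV : Nonempty V := by
    obtain ⟨a, ha⟩ := card_pos.1 (by omega : 0 < #A)
    exact ⟨t a⟩
  have hr := hD.rank_eq
  have mA := R.mono (subset_union_left.trans subset_union_right : A ⊆ F ∪ (A ∪ B))
  rw [disjoint_union_right] at hF
  -- After contracting a pair of rank 2 in a connected graph, rank `|V| - 3` remains. The natural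
  -- subtraction is exact, since rank 2 forces `|V| ≥ 3`.
  by_cases hX : ∀ X ⊆ F, ((Fintype.card V - 3 : ℕ) : ℤ) ≤
      (rank t h (X ∪ A) - rank t h A) + (rank t h (F \ X ∪ B) - rank t h B)
  · obtain ⟨T, hTF, hc, h1, h2⟩ :=
      (R.contract A).exists_common_independent (R.contract B) F _ hX
    refine absurd ⟨⟨spans_of_le_rank (by omega), ?_⟩, ⟨spans_of_le_rank (by omega), ?_⟩⟩ (hT T hTF)
    · rw [card_union_of_disjoint (hF.1.mono_left hTF)]; omega
    · rw [card_union_of_disjoint (hF.2.mono_left hTF)]; omega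
  · push Not at hX
    obtain ⟨X, hXF, hX⟩ := hX
    have hFA := Finset.disjoint_left.1 hF.1
    have hFB := Finset.disjoint_left.1 hF.2
    have hAB' := Finset.disjoint_left.1 hAB
    -- Undoing the two contractions adds 2 + 2 to a sum below `|V| - 3`, so the ranks of `X ∪ A` and
    -- its complement total at most `|V|`.
    refine separated_of_rank_add_rank_le (X := X ∪ A) hD subset_union_right
      (by rw [card_union_of_disjoint hAB, hA, hB]) ?_ ?_ ?_
    · have : (F ∪ (A ∪ B)) \ (X ∪ A) = F \ X ∪ B := by
        ext e
        have := @hFA e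
        have := @hFB e
        have := @hAB' e
        have := @hXF e
        simp only [mem_sdiff, mem_union]
        tauto
      rw [this]
      omega
    · rw [← hA]
      refine card_le_card fun e he => ?_
      have := @hFB e
      have := @hXF e
      simp only [mem_inter, mem_union] at he
      tauto
    · rw [← hB]
      refine card_le_card fun e he => ?_
      simp only [mem_sdiff, mem_union] at he
      tauto

/-- If `S` is separated, then for some division of `S` into two pairs, no set `T` of edges outside
`S` completes both pairs to spanning trees. -/
theorem Separated.exists_forall_not_isTree {D S : Finset E} (H : Separated t h D S) (hSD : S ⊆ D)
    (hS : #S = 4) : ∃ A B : Finset E, A ∪ B = S ∧ Disjoint A B ∧ #A = 2 ∧ #B = 2 ∧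
      ∀ T ⊆ D \ S, ¬ (IsTree t h (T ∪ A) ∧ IsTree t h (T ∪ B)) := by
  obtain ⟨X, U₁, U₂, hXD, hU, h₁, h₂, hc⟩ := H
  have hcap := card_inter_add_card_sdiff S X
  rw [inter_comm] at hcap
  -- `A` absorbs all edges of `S` in `X`, so that `B = S \ A` lies wholly in the other part.
  obtain ⟨A, hXA, hAS, hA⟩ : ∃ A, X ∩ S ⊆ A ∧ A ⊆ S ∧ #A = 2 :=
    exists_subsuperset_card_eq inter_subset_right (by omega) (by omega)
  have hAB : A ∪ S \ A = S := union_sdiff_of_subset hAS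
  have hB : #(S \ A) = 2 := by rw [card_sdiff_of_subset hAS]; omega
  refine ⟨A, S \ A, hAB, disjoint_sdiff, hA, hB, fun T hT ⟨tA, tB⟩ => ?_⟩
  have hTS : Disjoint T S := sdiff_disjoint.mono_left hT
  have hTD : T ⊆ D := hT.trans sdiff_subset
  have n₁ : U₁.Nonempty := by
    obtain ⟨e, he⟩ := card_pos.1 (by omega : 0 < #(X ∩ S))
    exact ⟨_, (h₁ e (mem_inter.1 he).1).1⟩
  have n₂ : U₂.Nonempty := by
    obtain ⟨e, he⟩ := card_pos.1 (by omega : 0 < #(S \ X))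
    rw [mem_sdiff] at he
    exact ⟨_, (h₂ e (hSD he.1) he.2).1⟩
  have cU := card_union_add_card_inter U₁ U₂
  rw [hU, card_univ] at cU
  have cT := card_inter_add_card_sdiff T X
  have dTA : #(T ∪ A) = #T + 2 := by
    rw [card_union_of_disjoint (hTS.mono_right hAS), hA]
  have := tA.2
  have p₁ : #(T ∩ X ∪ X ∩ S) + 1 ≤ #U₁ := by
    refine tA.card_add_one_le (union_subset_union inter_subset_left hXA) n₁ fun e he => h₁ e ?_
    simp only [mem_union, mem_inter] at he
    tauto
  have p₂ : #(T \ X ∪ S \ A) + 1 ≤ #U₂ := by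
    refine tB.card_add_one_le (union_subset_union sdiff_subset Subset.rfl) n₂ fun e he => ?_
    simp only [mem_union, mem_sdiff] at he
    have := @hTD e
    have := @hSD e
    have := fun hx hs => @hXA e (mem_inter.2 ⟨hx, hs⟩)
    exact h₂ e (by tauto) (by tauto)
  rw [card_union_of_disjoint (hTS.mono inter_subset_left inter_subset_right)] at p₁
  rw [card_union_of_disjoint (hTS.mono sdiff_subset sdiff_subset), hB] at p₂
  -- Adding `p₁` and `p₂` gives `#T + #(X ∩ S) + 4 ≤ |V| + #(U₁ ∩ U₂)`, whereas `|V| = #T + 3`.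
  rcases hc with ⟨hc, hc'⟩ | ⟨hc, hc'⟩
  · omega
  · have p₃ : #(T \ X ∪ A \ X) + 1 ≤ #U₂ := by
      refine tA.card_add_one_le (union_subset_union sdiff_subset sdiff_subset) n₂ fun e he => ?_
      simp only [mem_union, mem_sdiff] at he
      have := @hTD e
      have := @hSD e
      have := @hAS e
      exact h₂ e (by tauto) (by tauto)
    rw [card_union_of_disjoint (hTS.mono sdiff_subset (sdiff_subset.trans hAS))] at p₃
    omega

/-- Here `k` is the only edge leaving `W`. With few edges of `S` inside `W`, the part formed by `W`
and `k` meets the rest only in the far end of `k` and contains one or two edges of `S`. The deleted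
edge `e` is taken from the other side. -/
theorem separated_of_cut {D S : Finset E} {k : E} (hSD : S ⊆ D) (hS : #S = 5) (hk : k ∈ S)
    {W : Finset V} (hW : ∀ e ∈ D, e ≠ k → (t e ∈ W ↔ h e ∈ W)) (hkW : ¬ (t k ∈ W ↔ h k ∈ W))
    (hcard : #{e ∈ S.erase k | t e ∈ W} ≤ 1) :
    ∃ e ∈ S, Separated t h (D.erase e) (S.erase e) := by
  have hS' := card_erase_add_one hk
  obtain ⟨e, he, heW⟩ : ∃ e ∈ S.erase k, t e ∉ W := by
    by_contra! hcon
    rw [filter_true_of_mem hcon] at hcard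
    omega
  have hek : e ≠ k := ne_of_mem_erase he
  have hX : insert k {e ∈ D.erase k | t e ∈ W} ∩ S.erase e =
      insert k {e ∈ S.erase k | t e ∈ W} := by
    ext x
    simp only [mem_inter, mem_insert, mem_filter, mem_erase]
    have := @hSD x
    by_cases hx : x = k
    · simp [hx, hk, hek.symm]
    · by_cases hx' : x = e
      · simp [hx', heW, hek]
      · simp only [hx]; tauto
  refine ⟨e, mem_of_mem_erase he, insert k {e ∈ D.erase k | t e ∈ W}, W ∪ {t k, h k}, Wᶜ,
    ?_, ?_, ?_, ?_, ?_⟩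
  · intro x
    simp only [mem_insert, mem_filter, mem_erase]
    rintro (rfl | ⟨⟨hx, hxD⟩, hxW⟩)
    · exact ⟨hek.symm, hSD hk⟩
    · exact ⟨fun h => heW (h ▸ hxW), hxD⟩
  · ext v
    simp only [mem_union, mem_compl, mem_univ, iff_true]
    tauto
  · intro x
    simp only [mem_insert, mem_filter, mem_erase, mem_union, mem_singleton]
    rintro (rfl | ⟨⟨hx, hxD⟩, hxW⟩)
    · simp
    · exact ⟨.inl hxW, .inl ((hW x hxD hx).1 hxW)⟩
  · intro x hx hxX
    simp only [mem_insert, mem_filter, mem_erase, mem_compl] at hx hxX ⊢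
    have := hW x hx.2
    tauto
  · rw [hX, card_insert_of_notMem (by simp)]
    have : #((W ∪ {t k, h k}) ∩ Wᶜ) = 1 := by
      rw [card_eq_one]
      by_cases ht : t k ∈ W
      · refine ⟨h k, ?_⟩
        ext v
        simp only [mem_inter, mem_union, mem_compl, mem_insert, mem_singleton]
        constructor
        · rintro ⟨h1 | h1 | h1, h2⟩
          · exact absurd h1 h2
          · exact absurd (h1 ▸ ht) h2
          · exact h1
        · rintro rfl
          tauto
      · refine ⟨t k, ?_⟩
        ext v
        simp only [mem_inter, mem_union, mem_compl, mem_insert, mem_singleton]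
        constructor
        · rintro ⟨h1 | h1 | h1, h2⟩
          · exact absurd h1 h2
          · exact h1
          · subst h1; tauto
        · rintro rfl
          tauto
    rw [this]
    omega

/-- If the removal of an edge of `S` disconnects the graph, then `S` splits. -/
theorem exists_separated_of_not_spans_erase {D S : Finset E} {k : E} (hD : Spans t h D)
    (hSD : S ⊆ D) (hS : #S = 5) (hk : k ∈ S) (hkD : ¬ Spans t h (D.erase k)) :
    ∃ e ∈ S, Separated t h (D.erase e) (S.erase e) := by
  unfold Spans at hkD
  push Not at hkD
  obtain ⟨f, hf, u, v, huv⟩ := hkD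
  -- A level set of a potential of `D.erase k` is a cut that `k` alone can cross, and `k` must cross
  -- it because `D` is connected.
  let W : Finset V := {w | f w = f u}
  have mW : ∀ w, w ∈ W ↔ f w = f u := fun w => by simp [W]
  have hW : ∀ e ∈ D, e ≠ k → (t e ∈ W ↔ h e ∈ W) := fun e he hek => by
    rw [mW, mW, hf e (mem_erase.2 ⟨hek, he⟩)]
  have hkW : ¬ (t k ∈ W ↔ h k ∈ W) := by
    intro hkW
    have := hD (fun w => if w ∈ W then 1 else 0) (by
      intro e he
      have : t e ∈ W ↔ h e ∈ W := by
        by_cases hek : e = k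
        · rwa [hek]
        · exact hW e he hek
      simp only [this]) u v
    simp [mW, huv.symm] at this
  have hW' : ∀ e ∈ D, e ≠ k → (t e ∈ Wᶜ ↔ h e ∈ Wᶜ) := fun e he hek => by
    rw [mem_compl, mem_compl, hW e he hek]
  by_cases h1 : #{e ∈ S.erase k | t e ∈ W} ≤ 1
  · exact separated_of_cut hSD hS hk hW hkW h1
  by_cases h2 : #{e ∈ S.erase k | t e ∈ Wᶜ} ≤ 1
  · exact separated_of_cut hSD hS hk hW' (by rw [mem_compl, mem_compl]; tauto) h2
  have hcount := card_filter_add_card_filter_not (s := S.erase k) (fun e => t e ∈ W)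
  have hS' := card_erase_add_one hk
  simp only [mem_compl] at h2
  -- Each side now holds exactly two of the four remaining edges, so deleting `k` leaves two parts
  -- without common vertices.
  refine ⟨k, hk, {e ∈ D.erase k | t e ∈ W}, W, Wᶜ, filter_subset _ _, union_compl W, ?_, ?_,
    .inl ⟨by simp, ?_⟩⟩
  · intro e he
    simp only [mem_filter, mem_erase] at he
    exact ⟨he.2, (hW e he.1.2 he.1.1).1 he.2⟩
  · intro e he hne
    simp only [mem_filter, mem_erase, mem_compl] at he hne ⊢
    have := hW e he.2 he.1
    tauto
  · have : {e ∈ D.erase k | t e ∈ W} ∩ S.erase k = {e ∈ S.erase k | t e ∈ W} := by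
      ext e
      have := @hSD e
      simp only [mem_inter, mem_filter, mem_erase]
      tauto
    rw [this]
    omega

end SpanningTrees

/-! ### Specialising functions affine in each variable. -/

/-- In one variable, `x * a + b` takes a nonzero value if and only if `a` or `b` is nonzero, and
these are the values at `(1, 0)` and `(0, 1)`. The predicate `Q` carries the constraints on the
coordinates outside `F`, which lets the induction hold `e` fixed while it changes the others. -/
theorem exists_ne_zero_iff_of_affine {E : Type*} [DecidableEq E] (g : (E → ℚ × ℚ) → ℚ)
    (F : Finset E)
    (hg : ∀ e ∈ F, ∀ ρ x, g (Function.update ρ e (x, 1)) =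
      x * g (Function.update ρ e (1, 0)) + g (Function.update ρ e (0, 1)))
    (Q : (E → ℚ × ℚ) → Prop) (hQ : ∀ e ∈ F, ∀ ρ z, Q ρ → Q (Function.update ρ e z)) :
    (∃ ρ, Q ρ ∧ (∀ e ∈ F, (ρ e).2 = 1) ∧ g ρ ≠ 0) ↔
      ∃ ρ, Q ρ ∧ (∀ e ∈ F, ρ e = (1, 0) ∨ ρ e = (0, 1)) ∧ g ρ ≠ 0 := by
  induction F using Finset.induction_on generalizing Q with
  | empty => simp
  | insert e F he ih =>
    have hQF : ∀ e' ∈ F, ∀ ρ z, Q ρ → Q (Function.update ρ e' z) :=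
      fun e' he' => hQ e' (mem_insert_of_mem he')
    have hgF := fun e' he' => hg e' (mem_insert_of_mem he')
    have hne : ∀ e' ∈ F, e ≠ e' := fun e' he' h => he (h ▸ he')
    have hQe := hQ e (mem_insert_self e F)
    have hge := hg e (mem_insert_self e F)
    have hup : ∀ (ρ : E → ℚ × ℚ) z, ∀ e' ∈ F, Function.update ρ e z e' = ρ e' :=
      fun ρ z e' he' => Function.update_of_ne (hne e' he').symm _ _
    constructor
    · rintro ⟨ρ, hρ, hF, h0⟩
      obtain ⟨ρ, ⟨hρ, hρe⟩, hF, h0⟩ := (ih hgF (fun ρ => Q ρ ∧ (ρ e).2 = 1)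
        fun e' he' ρ z h => ⟨hQF e' he' ρ z h.1, by rw [Function.update_of_ne (hne e' he'), h.2]⟩).1
        ⟨ρ, ⟨hρ, hF e (mem_insert_self e F)⟩, fun e' he' => hF e' (mem_insert_of_mem he'), h0⟩
      have hρ' : ρ = Function.update ρ e ((ρ e).1, 1) := by
        rw [← hρe, Prod.mk.eta, Function.update_eq_self]
      rw [hρ', hge] at h0
      have key : ∀ z : ℚ × ℚ, z = (1, 0) ∨ z = (0, 1) → g (Function.update ρ e z) ≠ 0 →
          ∃ ρ, Q ρ ∧ (∀ e' ∈ insert e F, ρ e' = (1, 0) ∨ ρ e' = (0, 1)) ∧ g ρ ≠ 0 := by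
        intro z hz hgz
        refine ⟨_, hQe ρ z hρ, ?_, hgz⟩
        intro e' he'
        rcases mem_insert.1 he' with rfl | he'
        · simpa using hz
        · rw [hup _ _ _ he']; exact hF e' he'
      by_cases h1 : g (Function.update ρ e (1, 0)) = 0
      · refine key (0, 1) (.inr rfl) fun h2 => h0 (by rw [h1, h2]; simp)
      · exact key _ (.inl rfl) h1
    · rintro ⟨ρ, hρ, hF, h0⟩
      obtain ⟨ρ, ⟨hρ, hρe⟩, hF, h0⟩ :=
        (ih hgF (fun ρ => Q ρ ∧ (ρ e = (1, 0) ∨ ρ e = (0, 1))) fun e' he' ρ z h =>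
          ⟨hQF e' he' ρ z h.1, by rw [Function.update_of_ne (hne e' he')]; exact h.2⟩).2
        ⟨ρ, ⟨hρ, hF e (mem_insert_self e F)⟩, fun e' he' => hF e' (mem_insert_of_mem he'), h0⟩
      have key : ∀ x : ℚ, g (Function.update ρ e (x, 1)) ≠ 0 →
          ∃ ρ, Q ρ ∧ (∀ e' ∈ insert e F, (ρ e').2 = 1) ∧ g ρ ≠ 0 := by
        intro x hx
        refine ⟨_, hQe ρ _ hρ, ?_, hx⟩
        intro e' he'
        rcases mem_insert.1 he' with rfl | he'
        · simp
        · rw [hup _ _ _ he']; exact hF e' he'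
      by_cases h1 : g (Function.update ρ e (0, 1)) = 0
      · refine key 1 ?_
        rw [hge, h1]
        rcases hρe with hρe | hρe
        · rw [← hρe, Function.update_eq_self]; simpa using h0
        · rw [← hρe, Function.update_eq_self] at h1; exact absurd h1 h0
      · exact key 0 (by rw [hge]; simpa using h1)

theorem spans_iff_forall_eq_zero {V E : Type*} {t h : E → V} (r : V) {B : Finset E} :
    Spans t h B ↔ ∀ f ∈ potentials t h B, f r = 0 → f = 0 := by
  constructor
  · intro H f hf hr
    ext v
    rw [H f hf v r, hr, Pi.zero_apply]
  · intro H f hf u v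
    have := H (fun v => f v - f r) (fun e he => by simp [hf e he]) (sub_self _)
    have hu := congrFun this u
    have hv := congrFun this v
    simp only [Pi.zero_apply] at hu hv
    linarith

/-! ### Forests and spanning sets in the reduced incidence matrix. -/

section Incidence

variable {V E : Type*} [Fintype V] [DecidableEq V] [Fintype E] (t h : E → V) (r : V)

/-- The rows of `B` in the incidence matrix without the column of `r` are linearly independent. -/
def IsForest (B : Finset E) : Prop :=
  ∀ y : E → ℚ, (∀ e ∉ B, y e = 0) →
    (∀ v ≠ r, ∑ e, y e * ((if h e = v then 1 else 0) - (if t e = v then 1 else 0)) = 0) → y = 0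

variable {t h}

-- Forests correspond to independent rows and spanning sets to independent columns of the block of
-- `B`. It has `|V| - 1` columns, so row independence bounds `#B`, and for a square block the two
-- conditions agree.
open Classical in
theorem isForest_iff_isTree {B : Finset E} :
    (IsForest t h r B → #B + 1 ≤ Fintype.card V) ∧
      (#B + 1 = Fintype.card V → (IsForest t h r B ↔ Spans t h B)) := by
  let A : Matrix B {v : V // v ≠ r} ℚ := fun e v =>
    (if h e = v then 1 else 0) - (if t e = v then 1 else 0)
  have hV : Fintype.card {v : V // v ≠ r} + 1 = Fintype.card V := by
    have := Fintype.card_pos_iff.2 ⟨r⟩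
    rw [Fintype.card_subtype_compl, Fintype.card_subtype_eq]
    omega
  have sum_eq' : ∀ (y : B → ℚ) v, A.vecMulLinear y v =
      ∑ e : B, y e * ((if h e = v then 1 else 0) - (if t e = v then 1 else 0)) := fun _ _ => rfl
  have h1 : IsForest t h r B ↔ LinearIndependent ℚ A.row := by
    rw [← Matrix.vecMul_injective_iff, ← Matrix.coe_vecMulLinear, ← LinearMap.ker_eq_bot,
      LinearMap.ker_eq_bot']
    constructor
    · intro H y hy
      have := H (fun e => if he : e ∈ B then y ⟨e, he⟩ else 0) (fun e he => by simp [he]) (by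
        intro v hv
        have := congrFun hy ⟨v, hv⟩
        rw [sum_eq', Pi.zero_apply] at this
        refine Eq.trans ?_ this
        rw [← Finset.sum_subset (Finset.subset_univ B), ← Finset.sum_coe_sort B]
        · refine Finset.sum_congr rfl fun e _ => ?_
          rw [dif_pos e.2]
        · intro e _ he
          rw [dif_neg he, zero_mul])
      ext ⟨e, he⟩
      simpa [he] using congrFun this e
    · intro H y hy hv
      have := H (fun e => y e) (by
        ext ⟨v, hvr⟩
        rw [sum_eq', Pi.zero_apply]
        refine Eq.trans ?_ (hv v hvr)
        rw [← Finset.sum_subset (Finset.subset_univ B), ← Finset.sum_coe_sort B]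
        intro e _ he
        rw [hy e he, zero_mul])
      ext e
      by_cases he : e ∈ B
      · exact congrFun this ⟨e, he⟩
      · exact hy e he
  have h2 : Spans t h B ↔ LinearIndependent ℚ A.col := by
    rw [← Matrix.mulVec_injective_iff, ← Matrix.coe_mulVecLin, ← LinearMap.ker_eq_bot,
      LinearMap.ker_eq_bot', spans_iff_forall_eq_zero r]
    have sum_eq : ∀ (f : V → ℚ), f r = 0 → ∀ e : B,
        (A.mulVec fun v => f v) e = f (h e) - f (t e) := by
      intro f hf e
      have key : ∀ w : V, ∑ v : {v : V // v ≠ r}, (if w = v then 1 else 0) * f v = f w := by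
        intro w
        by_cases hw : w = r
        · subst hw
          rw [hf]
          exact Finset.sum_eq_zero fun v _ => by simp [v.2.symm]
        · rw [Finset.sum_eq_single ⟨w, hw⟩]
          · simp
          · intro v _ hv
            rw [if_neg, zero_mul]
            rintro rfl
            exact hv rfl
          · simp
      simp only [Matrix.mulVec, dotProduct, A, sub_mul, Finset.sum_sub_distrib, key]
    constructor
    · intro H f hf
      let f' : V → ℚ := fun v => if hv : v ≠ r then f ⟨v, hv⟩ else 0
      have hf' : (fun v : {v : V // v ≠ r} => f' v) = f := by
        ext ⟨v, hv⟩
        simp [f', hv]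
      have := H f' (fun e he => by
        have := sum_eq f' (by simp [f']) ⟨e, he⟩
        rw [hf', ← Matrix.mulVecLin_apply, hf] at this
        simp only [Pi.zero_apply] at this
        linarith) (by simp [f'])
      rw [← hf', this]
      rfl
    · intro H f hf hr
      have := H (fun v => f v) (by
        ext e
        rw [Matrix.mulVecLin_apply, sum_eq f hr e, hf e e.2]
        simp)
      ext v
      by_cases hv : v = r
      · rw [hv, hr]; rfl
      · exact congrFun this ⟨v, hv⟩
  rw [h1, h2, linearIndependent_iff_card_eq_finrank_span,
    linearIndependent_iff_card_eq_finrank_span, Set.finrank, Set.finrank,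
    ← Matrix.rank_eq_finrank_span_cols, ← Matrix.rank_eq_finrank_span_row,
    Fintype.card_coe]
  have := A.rank_le_card_width
  omega

end Incidence

/-! ### Dodgson polynomials as minors with homogenised edge variables. -/

section Weighted

variable {α β : Type*} {G : Graph α β} (o : Orientation G) (r : V(G))

open Classical in
/-- The matrix `[P, Qξ; -ξᵀ, 0]`, where `ξ` is the reduced incidence matrix and `(P, Q)` are the
diagonal matrices with the entries of `ρ`. -/
noncomputable def weightedMatrix (ρ : E(G) → ℚ × ℚ) :
    Matrix (E(G) ⊕ {v : V(G) // v ≠ r}) (E(G) ⊕ {v : V(G) // v ≠ r}) ℚ :=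
  Matrix.fromBlocks (Matrix.diagonal fun e => (ρ e).1)
    (fun e v => (ρ e).2 * ((if o.head e = v.1 then 1 else 0) - (if o.tail e = v.1 then 1 else 0)))
    (fun v e => -((if o.head e = v.1 then 1 else 0) - (if o.tail e = v.1 then 1 else 0))) 0

open Classical in
theorem kirchhoffMatrix_inl_inl (K : Set β) (e e' : E(G)) :
    kirchhoffMatrix o r K (.inl e) (.inl e') =
      if e = e' then (if (e : β) ∈ K then 0 else MvPolynomial.X e) else 0 :=
  Matrix.diagonal_apply
    (fun e : E(G) => if (e : β) ∈ K then 0 else (MvPolynomial.X e : MvPolynomial E(G) ℤ)) e e'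

open Classical in
theorem kirchhoffMatrix_inl_inr (K : Set β) (e : E(G)) (v : {v : V(G) // v ≠ r}) :
    kirchhoffMatrix o r K (.inl e) (.inr v) =
      (if o.head e = v.1 then 1 else 0) - (if o.tail e = v.1 then 1 else 0) := rfl

open Classical in
theorem kirchhoffMatrix_inr_inl (K : Set β) (v : {v : V(G) // v ≠ r}) (e : E(G)) :
    kirchhoffMatrix o r K (.inr v) (.inl e) =
      -((if o.head e = v.1 then 1 else 0) - (if o.tail e = v.1 then 1 else 0)) := rfl

theorem kirchhoffMatrix_inr_inr (K : Set β) (v w : {v : V(G) // v ≠ r}) :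
    kirchhoffMatrix o r K (.inr v) (.inr w) = 0 := rfl

open Classical in
theorem weightedMatrix_inl_inl (ρ : E(G) → ℚ × ℚ) (e e' : E(G)) :
    weightedMatrix o r ρ (.inl e) (.inl e') = if e = e' then (ρ e).1 else 0 :=
  Matrix.diagonal_apply (fun e => (ρ e).1) e e'

open Classical in
theorem weightedMatrix_inl_inr (ρ : E(G) → ℚ × ℚ) (e : E(G)) (v : {v : V(G) // v ≠ r}) :
    weightedMatrix o r ρ (.inl e) (.inr v) =
      (ρ e).2 * ((if o.head e = v.1 then 1 else 0) - (if o.tail e = v.1 then 1 else 0)) := rfl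

open Classical in
theorem weightedMatrix_inr_inl (ρ : E(G) → ℚ × ℚ) (v : {v : V(G) // v ≠ r}) (e : E(G)) :
    weightedMatrix o r ρ (.inr v) (.inl e) =
      -((if o.head e = v.1 then 1 else 0) - (if o.tail e = v.1 then 1 else 0)) := rfl

theorem weightedMatrix_inr_inr (ρ : E(G) → ℚ × ℚ) (v w : {v : V(G) // v ≠ r}) :
    weightedMatrix o r ρ (.inr v) (.inr w) = 0 := rfl

open Classical in
/-- The minor of the weighted matrix in which the rows in `I` and the columns in `J` are deleted. -/
noncomputable def weightedMinor [Finite V(G)] [Finite E(G)] (I J : Set β)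
    (σ : Remaining r I ≃ Remaining r J) (ρ : E(G) → ℚ × ℚ) : ℚ :=
  letI : Fintype (Remaining r I) := Fintype.ofFinite _
  ((weightedMatrix o r ρ).submatrix (Remaining.incl r I) (fun i => Remaining.incl r J (σ i))).det

variable {I J : Set β} {K : Set β} (σ : Remaining r I ≃ Remaining r J)

-- A polynomial over `ℤ` stays nonzero over `ℚ`, and over this infinite field it is detected by its
-- values.
open Classical in
theorem dodgson_ne_zero_iff_exists_weightedMinor [Finite V(G)] [Finite E(G)] :
    dodgson o r I J K σ ≠ 0 ↔ ∃ x : E(G) → ℚ,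
      weightedMinor o r I J σ (fun e => (if (e : β) ∈ K then 0 else x e, 1)) ≠ 0 := by
  have key : ∀ x : E(G) → ℚ,
      MvPolynomial.eval x (MvPolynomial.map (Int.castRingHom ℚ) (dodgson o r I J K σ)) =
      weightedMinor o r I J σ (fun e => (if (e : β) ∈ K then 0 else x e, 1)) := by
    intro x
    let _ : Fintype (Remaining r I) := Fintype.ofFinite _
    unfold dodgson weightedMinor
    rw [RingHom.map_det, RingHom.map_det]
    congr 1
    ext i j
    simp only [RingHom.mapMatrix_apply, Matrix.map_apply, Matrix.submatrix_apply]
    generalize Remaining.incl r I i = a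
    generalize Remaining.incl r J (σ j) = b
    rcases a with a | a <;> rcases b with b | b
    · rw [kirchhoffMatrix_inl_inl, weightedMatrix_inl_inl]
      split_ifs <;> simp
    · rw [kirchhoffMatrix_inl_inr, weightedMatrix_inl_inr]
      split_ifs <;> simp
    · rw [kirchhoffMatrix_inr_inl, weightedMatrix_inr_inl]
      split_ifs <;> simp
    · rw [kirchhoffMatrix_inr_inr, weightedMatrix_inr_inr]
      simp
  simp only [← key]
  constructor
  · intro hne
    by_contra! hcon
    refine hne (MvPolynomial.map_injective (Int.castRingHom ℚ) Int.cast_injective ?_)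
    rw [map_zero]
    exact MvPolynomial.funext fun x => by rw [hcon x, map_zero]
  · rintro ⟨x, hx⟩ h0
    exact hx (by rw [h0]; simp)

-- Only the row of `e` depends on `ρ e`, and it does so linearly; that row is present because `e ∉
-- I`.
open Classical in
theorem weightedMinor_update [Finite V(G)] [Finite E(G)] {e : E(G)} (he : (e : β) ∉ I)
    (ρ : E(G) → ℚ × ℚ) (x : ℚ) :
    weightedMinor o r I J σ (Function.update ρ e (x, 1)) =
      x * weightedMinor o r I J σ (Function.update ρ e (1, 0)) +
        weightedMinor o r I J σ (Function.update ρ e (0, 1)) := by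
  let _ : Fintype (Remaining r I) := Fintype.ofFinite _
  let N : ℚ × ℚ → Matrix (Remaining r I) (Remaining r I) ℚ := fun z =>
    (weightedMatrix o r (Function.update ρ e z)).submatrix (Remaining.incl r I)
      (fun i => Remaining.incl r J (σ i))
  have hN : ∀ z z', N z = (N z').updateRow (.inl ⟨e, he⟩) (N z (.inl ⟨e, he⟩)) := by
    intro z z'
    ext i j
    by_cases hi : i = .inl ⟨e, he⟩
    · rw [hi, Matrix.updateRow_self]
    · rw [Matrix.updateRow_ne hi]
      rcases i with ⟨e', he'⟩ | v
      · have : e' ≠ e := by rintro rfl; exact hi rfl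
        simp only [N, Matrix.submatrix_apply, Remaining.incl, Sum.map_inl]
        rcases σ j with b | b
        · rw [Sum.map_inl, weightedMatrix_inl_inl, weightedMatrix_inl_inl]
          simp only [Function.update_of_ne this]
        · rw [Sum.map_inr, weightedMatrix_inl_inr, weightedMatrix_inl_inr]
          simp only [Function.update_of_ne this]
      · simp only [N, Matrix.submatrix_apply, Remaining.incl, Sum.map_inr]
        rcases σ j with b | b <;> rfl
  have hrow : N (x, 1) (.inl ⟨e, he⟩) =
      x • N (1, 0) (.inl ⟨e, he⟩) + N (0, 1) (.inl ⟨e, he⟩) := by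
    ext j
    simp only [N, Matrix.submatrix_apply, Remaining.incl, Sum.map_inl, Pi.add_apply, Pi.smul_apply,
      smul_eq_mul]
    rcases σ j with b | b
    · simp only [Sum.map_inl, weightedMatrix_inl_inl, Function.update_self]
      split_ifs <;> simp
    · simp only [Sum.map_inr, weightedMatrix_inl_inr, Function.update_self]
      simp
  change (N (x, 1)).det = x * (N (1, 0)).det + (N (0, 1)).det
  rw [hN (x, 1) (0, 1), hrow, Matrix.det_updateRow_add, Matrix.det_updateRow_smul,
    ← hN (1, 0) (0, 1), Matrix.updateRow_eq_self]

-- This is injectivity of the minor, spelled out on vectors `(y, f)` extended by zero to the deleted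
-- columns `J` and to `r`. Thus `f` is a potential grounded at `r` and `y` is a flow.
open Classical in
theorem weightedMinor_ne_zero_iff [Fintype V(G)] [Fintype E(G)] (ρ : E(G) → ℚ × ℚ) :
    weightedMinor o r I J σ ρ ≠ 0 ↔ ∀ (y : E(G) → ℚ) (f : V(G) → ℚ),
      (∀ e : E(G), (e : β) ∈ J → y e = 0) → f r = 0 →
      (∀ e : E(G), (e : β) ∉ I →
        (ρ e).1 * y e + (ρ e).2 * (f (o.head e) - f (o.tail e)) = 0) →
      (∀ v ≠ r, ∑ e, y e * ((if o.head e = v then 1 else 0) - (if o.tail e = v then 1 else 0)) = 0)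
      → y = 0 ∧ f = 0 := by
  let _ : Fintype (Remaining r I) := Fintype.ofFinite _
  let M := (weightedMatrix o r ρ).submatrix (Remaining.incl r I) (Remaining.incl r J)
  have sum_y : ∀ (g y : E(G) → ℚ), (∀ e : E(G), (e : β) ∈ J → y e = 0) →
      ∑ e : {e : E(G) // (e : β) ∉ J}, g e * y e = ∑ e, g e * y e := by
    intro g y hy
    rw [← Finset.sum_subtype (univ.filter fun e : E(G) => (e : β) ∉ J) (by simp)
      (fun e => g e * y e)]
    refine Finset.sum_subset (Finset.subset_univ _) fun e _ he => ?_
    rw [hy e (by simpa using he), mul_zero]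
  have sum_f : ∀ (f : V(G) → ℚ), f r = 0 → ∀ w,
      ∑ v : {v : V(G) // v ≠ r}, (if w = v.1 then 1 else 0) * f v = f w := by
    intro f hf w
    rw [← Finset.sum_subtype (univ.erase r) (by simp) (fun v => (if w = v then 1 else 0) * f v),
      Finset.sum_erase _ (by rw [hf, mul_zero])]
    simp
  have mulVec_eq : ∀ (y : {e : E(G) // (e : β) ∉ J} → ℚ) (f : {v : V(G) // v ≠ r} → ℚ)
      (i : Remaining r I), M.mulVec (Sum.elim y f) i =
        ∑ e : {e : E(G) // (e : β) ∉ J},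
            weightedMatrix o r ρ (Remaining.incl r I i) (.inl e) * y e +
          ∑ v, weightedMatrix o r ρ (Remaining.incl r I i) (.inr v) * f v :=
    fun y f i => Fintype.sum_sum_type fun j => M i j * Sum.elim y f j
  have mul_inl : ∀ (y : E(G) → ℚ) (f : V(G) → ℚ), (∀ e : E(G), (e : β) ∈ J → y e = 0) →
      f r = 0 → ∀ e : {e : E(G) // (e : β) ∉ I},
      M.mulVec (Sum.elim (fun e => y e) (fun v => f v)) (.inl e) =
        (ρ e).1 * y e + (ρ e).2 * (f (o.head e) - f (o.tail e)) := by
    intro y f hy hf e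
    rw [mulVec_eq]
    simp only [Remaining.incl, Sum.map_inl, weightedMatrix_inl_inl, weightedMatrix_inl_inr]
    rw [sum_y (fun e' => if e.1 = e' then (ρ e).1 else 0) y hy]
    simp only [mul_assoc, ← Finset.mul_sum, sub_mul, Finset.sum_sub_distrib, sum_f f hf]
    simp
  have mul_inr : ∀ (y : E(G) → ℚ) (f : V(G) → ℚ), (∀ e : E(G), (e : β) ∈ J → y e = 0) →
      ∀ v : {v : V(G) // v ≠ r},
      M.mulVec (Sum.elim (fun e => y e) (fun v => f v)) (.inr v) =
        -∑ e, y e * ((if o.head e = v.1 then 1 else 0) - (if o.tail e = v.1 then 1 else 0)) := by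
    intro y f hy v
    rw [mulVec_eq]
    simp only [Remaining.incl, Sum.map_inr, id, weightedMatrix_inr_inl, weightedMatrix_inr_inr,
      zero_mul, Finset.sum_const_zero, add_zero]
    rw [sum_y (fun e => -((if o.head e = v.1 then 1 else 0) - (if o.tail e = v.1 then 1 else 0)))
      y hy, ← Finset.sum_neg_distrib]
    refine Finset.sum_congr rfl fun e _ => ?_
    ring
  have hdet : weightedMinor o r I J σ ρ ≠ 0 ↔ ∀ w, M.mulVec w = 0 → w = 0 := by
    have h1 : weightedMinor o r I J σ ρ = (M.submatrix id σ).det := rfl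
    rw [h1, ne_eq, ← Matrix.exists_mulVec_eq_zero_iff]
    push Not
    constructor
    · intro H w hw
      by_contra hne
      refine H (w ∘ σ) (fun h0 => hne ?_) ?_
      · ext i
        simpa using congrFun h0 (σ.symm i)
      · rw [Matrix.submatrix_mulVec_equiv, Function.comp_assoc, Equiv.self_comp_symm,
          Function.comp_id, Function.comp_id, hw]
    · intro H w hne hw
      rw [Matrix.submatrix_mulVec_equiv, Function.comp_id] at hw
      refine hne ?_
      ext i
      simpa using congrFun (H _ hw) (σ i)
  rw [hdet]
  constructor
  · intro H y f hy hf h1 h2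
    have := H (Sum.elim (fun e => y e) (fun v => f v)) (by
      ext i
      rcases i with e | v
      · rw [mul_inl y f hy hf, h1 e e.2]; rfl
      · rw [mul_inr y f hy, h2 v v.2, neg_zero]; rfl)
    constructor
    · ext e
      by_cases he : (e : β) ∈ J
      · exact hy e he
      · exact congrFun this (.inl ⟨e, he⟩)
    · ext v
      by_cases hv : v = r
      · rw [hv, hf]; rfl
      · exact congrFun this (.inr ⟨v, hv⟩)
  · intro H w hw
    let y : E(G) → ℚ := fun e => if he : (e : β) ∉ J then w (.inl ⟨e, he⟩) else 0
    let f : V(G) → ℚ := fun v => if hv : v ≠ r then w (.inr ⟨v, hv⟩) else 0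
    have hy : ∀ e : E(G), (e : β) ∈ J → y e = 0 := fun e he => dif_neg (not_not.2 he)
    have hf : f r = 0 := dif_neg (not_not.2 rfl)
    have hyw : Sum.elim (fun e : {e : E(G) // (e : β) ∉ J} => y e)
        (fun v : {v : V(G) // v ≠ r} => f v) = w := by
      ext i
      rcases i with e | v
      · exact dif_pos e.2
      · exact dif_pos v.2
    have := H y f hy hf
      (fun e he => by rw [← mul_inl y f hy hf ⟨e, he⟩, hyw, hw]; rfl)
      (fun v hv => by rw [← neg_eq_zero, ← mul_inr y f hy ⟨v, hv⟩, hyw, hw]; rfl)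
    rw [← hyw, this.1, this.2]
    ext i
    rcases i with e | v <;> rfl

end Weighted

open Classical in
/-- A Dodgson polynomial is nonzero if and only if some set of edges outside `S = I ∪ J ∪ K`
completes both `(J \ I) ∪ K` and `(I \ J) ∪ K` to spanning trees. -/
theorem dodgson_ne_zero_iff {α β : Type*} {G : Graph α β} [Fintype V(G)] [Fintype E(G)]
    (o : Orientation G) (r : V(G)) {I J K : Set β} (σ : Remaining r I ≃ Remaining r J)
    {I' J' K' : Finset E(G)} (hI : ∀ e : E(G), e ∈ I' ↔ (e : β) ∈ I)
    (hJ : ∀ e : E(G), e ∈ J' ↔ (e : β) ∈ J) (hK : ∀ e : E(G), e ∈ K' ↔ (e : β) ∈ K)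
    (hIK : Disjoint I' K') (hJK : Disjoint J' K') (hc : #I' = #J') :
    dodgson o r I J K σ ≠ 0 ↔ ∃ T : Finset E(G), Disjoint T (I' ∪ J' ∪ K') ∧
      IsTree o.tail o.head (T ∪ (J' \ I' ∪ K')) ∧ IsTree o.tail o.head (T ∪ (I' \ J' ∪ K')) := by
  have dIK := Finset.disjoint_left.1 hIK
  have dJK := Finset.disjoint_left.1 hJK
  have hcard : ∀ T : Finset E(G), Disjoint T (I' ∪ J' ∪ K') →
      #(T ∪ (J' \ I' ∪ K')) = #(T ∪ (I' \ J' ∪ K')) := by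
    intro T hT
    rw [card_union_of_disjoint (hT.mono_right (union_subset_union
        (sdiff_subset.trans subset_union_right) Subset.rfl)),
      card_union_of_disjoint (hT.mono_right (union_subset_union
        (sdiff_subset.trans subset_union_left) Subset.rfl)),
      card_union_of_disjoint (hJK.mono_left sdiff_subset),
      card_union_of_disjoint (hIK.mono_left sdiff_subset)]
    have h1 := card_sdiff_add_card_inter I' J'
    have h2 := card_sdiff_add_card_inter J' I'
    rw [inter_comm] at h2
    omega
  rw [dodgson_ne_zero_iff_exists_weightedMinor]
  let Q : (E(G) → ℚ × ℚ) → Prop := fun ρ =>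
    ∀ e ∈ I' ∪ J' ∪ K', (ρ e).2 = 1 ∧ (e ∈ K' → (ρ e).1 = 0)
  have h1 : (∃ x : E(G) → ℚ,
      weightedMinor o r I J σ (fun e => (if (e : β) ∈ K then 0 else x e, 1)) ≠ 0) ↔
      ∃ ρ, Q ρ ∧ (∀ e ∈ (I' ∪ J' ∪ K')ᶜ, (ρ e).2 = 1) ∧ weightedMinor o r I J σ ρ ≠ 0 := by
    constructor
    · rintro ⟨x, hx⟩
      exact ⟨_, fun e _ => ⟨rfl, fun he => if_pos ((hK e).1 he)⟩, fun _ _ => rfl, hx⟩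
    · rintro ⟨ρ, hQ, h2, hρ⟩
      refine ⟨fun e => (ρ e).1, ?_⟩
      convert hρ using 2
      ext e
      · by_cases he : (e : β) ∈ K
        · have := (hK e).2 he
          simp [he, (hQ e (by simp [this])).2 this]
        · simp [he]
      · by_cases he : e ∈ I' ∪ J' ∪ K'
        · exact (hQ e he).1.symm
        · exact (h2 e (mem_compl.2 he)).symm
  rw [h1, exists_ne_zero_iff_of_affine (weightedMinor o r I J σ) (I' ∪ J' ∪ K')ᶜ
    (fun e he ρ x => weightedMinor_update o r σ (by
      rw [← hI]; simp only [mem_compl, mem_union] at he; tauto) ρ x) Q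
    (fun e he ρ z hρ e' he' => by
      have : e' ≠ e := by rintro rfl; exact mem_compl.1 he he'
      rw [Function.update_of_ne this]
      exact hρ e' he')]
  have key : ∀ T : Finset E(G), Disjoint T (I' ∪ J' ∪ K') → ∀ ρ, Q ρ →
      (∀ e ∈ T, ρ e = (0, 1)) → (∀ e ∈ (I' ∪ J' ∪ K')ᶜ, e ∉ T → ρ e = (1, 0)) →
      (weightedMinor o r I J σ ρ ≠ 0 ↔
        IsTree o.tail o.head (T ∪ (J' \ I' ∪ K')) ∧
          IsTree o.tail o.head (T ∪ (I' \ J' ∪ K'))) := by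
    intro T hT ρ hQ hρT hρ
    have dT := Finset.disjoint_left.1 hT
    -- The equation of an edge with weight `(0, 1)` equates `f` at its ends and leaves `y` free;
    -- with `(1, 0)` it kills `y`. Edges of `J \ I` have no `y`, edges of `I \ J` have no equation,
    -- and edges of `K` behave like those of `T`. So the system for `f` lives on one edge set and
    -- that for `y` on the other.
    have hiff : weightedMinor o r I J σ ρ ≠ 0 ↔
        Spans o.tail o.head (T ∪ (J' \ I' ∪ K')) ∧
          IsForest o.tail o.head r (T ∪ (I' \ J' ∪ K')) := by
      rw [weightedMinor_ne_zero_iff, spans_iff_forall_eq_zero r]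
      constructor
      · intro H
        constructor
        · intro f hf hr
          refine (H 0 f (fun _ _ => rfl) hr ?_ (by simp)).2
          intro e he
          rw [← hI] at he
          by_cases heS : e ∈ T ∪ (J' \ I' ∪ K')
          · rw [hf e heS]; simp
          · simp only [mem_union, mem_sdiff, not_or, not_and_or, not_not] at heS
            rw [hρ e (by simp only [mem_compl, mem_union]; tauto) heS.1]
            simp
        · intro y hy hv
          refine (H y 0 ?_ rfl ?_ hv).1
          · intro e he
            rw [← hJ] at he
            refine hy e ?_
            have := @dT e
            have := @dJK e
            simp only [mem_union, mem_sdiff] at this ⊢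
            simp only [mem_union] at *
            tauto
          · intro e he
            rw [← hI] at he
            by_cases heS : e ∈ T ∪ (I' \ J' ∪ K')
            · simp only [mem_union, mem_sdiff] at heS
              rcases heS with h | h | h
              · rw [hρT e h]; simp
              · exact absurd h.1 he
              · rw [(hQ e (by simp [h])).2 h]; simp
            · rw [hy e heS]; simp
      · rintro ⟨H1, H2⟩ y f hy hr h1 h2
        have hy0 : y = 0 := by
          refine H2 y (fun e he => ?_) h2
          by_cases heJ : (e : β) ∈ J
          · exact hy e heJ
          · rw [← hJ] at heJ
            simp only [mem_union, mem_sdiff, not_or, not_and_or, not_not] at he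
            have heI : e ∉ I' := by tauto
            have := h1 e (by rwa [← hI])
            rw [hρ e (by simp only [mem_compl, mem_union]; tauto) he.1] at this
            simpa using this
        refine ⟨hy0, H1 f (fun e he => ?_) hr⟩
        have heI : e ∉ I' := by
          have := @dT e
          have := @dIK e
          simp only [mem_union, mem_sdiff] at *
          tauto
        have h3 := h1 e (by rwa [← hI])
        have h4 : (ρ e).2 = 1 := by
          simp only [mem_union, mem_sdiff] at he
          rcases he with h | h | h
          · rw [hρT e h]
          · exact (hQ e (by simp [h.1])).1
          · exact (hQ e (by simp [h])).1
        rw [hy0, h4] at h3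
        simp only [Pi.zero_apply, mul_zero, zero_add, one_mul] at h3
        linarith
    -- A spanning set has at least `|V| - 1` edges and a forest at most that many; since the two
    -- sets are equinumerous, both are trees.
    rw [hiff]
    have hV : Nonempty V(G) := ⟨r⟩
    obtain ⟨f1, f2⟩ := isForest_iff_isTree (t := o.tail) (h := o.head) r
      (B := T ∪ (I' \ J' ∪ K'))
    have hc := hcard T hT
    constructor
    · rintro ⟨H1, H2⟩
      have a1 := H1.rank_eq
      have a2 := (isRank_rank (t := o.tail) (h := o.head)).le_card (T ∪ (J' \ I' ∪ K'))
      have a3 := f1 H2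
      have a4 : #(T ∪ (I' \ J' ∪ K')) + 1 = Fintype.card V(G) := by omega
      exact ⟨⟨H1, by omega⟩, ⟨(f2 a4).1 H2, a4⟩⟩
    · rintro ⟨H1, H2⟩
      exact ⟨H1.1, (f2 H2.2).2 H2.1⟩
  constructor
  · rintro ⟨ρ, hQ, hρ, h0⟩
    have hT : Disjoint {e ∈ (I' ∪ J' ∪ K')ᶜ | ρ e = (0, 1)} (I' ∪ J' ∪ K') :=
      disjoint_compl_left.mono_left (filter_subset _ _)
    refine ⟨_, hT, (key _ hT ρ hQ (fun e he => (mem_filter.1 he).2) ?_).1 h0⟩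
    intro e he heT
    rcases hρ e he with h | h
    · exact h
    · exact absurd (mem_filter.2 ⟨he, h⟩) heT
  · rintro ⟨T, hT, hTT⟩
    have dT := Finset.disjoint_left.1 hT
    let ρ : E(G) → ℚ × ℚ := fun e => if e ∈ T ∪ (I' ∪ J' ∪ K') then (0, 1) else (1, 0)
    have hQ : Q ρ := by
      intro e he
      have : ρ e = (0, 1) := if_pos (mem_union_right _ he)
      simp [this]
    have hρT : ∀ e ∈ T, ρ e = (0, 1) := fun e he => if_pos (mem_union_left _ he)
    have hρ : ∀ e ∈ (I' ∪ J' ∪ K')ᶜ, e ∉ T → ρ e = (1, 0) := fun e he heT =>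
      if_neg fun h => (mem_union.1 h).elim heT (mem_compl.1 he)
    refine ⟨ρ, hQ, fun e he => ?_, (key T hT ρ hQ hρT hρ).2 hTT⟩
    by_cases heT : e ∈ T
    · exact .inr (hρT e heT)
    · exact .inl (hρ e he heT)

/-! ### Spanning trees of a contraction. -/

section Contraction

variable {V V' E : Type*} {t h : E → V} {k : E} {π : V → V'}

/-- Potentials that agree at the two ends of `k` are the ones that factor through the identification
`π`. -/
theorem spans_comp_iff [DecidableEq E] (hs : Function.Surjective π)
    (hπ : ∀ u v, π u = π v ↔ u = v ∨ (u = t k ∧ v = h k) ∨ (u = h k ∧ v = t k)) {X : Finset E} :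
    Spans (π ∘ t) (π ∘ h) X ↔ Spans t h (insert k X) := by
  constructor
  · intro H f hf u v
    have hk : f (t k) = f (h k) := hf k (mem_insert_self k X)
    have key : ∀ u v, π u = π v → f u = f v := by
      intro u v huv
      rcases (hπ u v).1 huv with rfl | ⟨rfl, rfl⟩ | ⟨rfl, rfl⟩
      · rfl
      · exact hk
      · exact hk.symm
    have hg : ∀ v, f (Function.surjInv hs (π v)) = f v :=
      fun v => key _ _ (Function.surjInv_eq hs (π v))
    have := H (f ∘ Function.surjInv hs) (fun e he => by
      simp only [Function.comp_apply, hg]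
      exact hf e (mem_insert_of_mem he)) (π u) (π v)
    simpa only [Function.comp_apply, hg] using this
  · intro H g hg u v
    obtain ⟨u, rfl⟩ := hs u
    obtain ⟨v, rfl⟩ := hs v
    refine H (g ∘ π) (fun e he => ?_) u v
    rcases mem_insert.1 he with rfl | he
    · exact congrArg g ((hπ _ _).2 (.inr (.inl ⟨rfl, rfl⟩)))
    · exact hg e he

theorem card_add_one_eq_of_contraction [Fintype V] [Fintype V'] (hs : Function.Surjective π)
    (hπ : ∀ u v, π u = π v ↔ u = v ∨ (u = t k ∧ v = h k) ∨ (u = h k ∧ v = t k))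
    (hk : t k ≠ h k) : Fintype.card V' + 1 = Fintype.card V := by
  classical
  have hinj : Set.InjOn π (univ.erase (h k) : Finset V) := by
    intro u hu v hv huv
    simp only [coe_erase, coe_univ, Set.mem_sdiff, Set.mem_univ, Set.mem_singleton_iff,
      true_and] at hu hv
    rcases (hπ u v).1 huv with h | h | h
    · exact h
    · exact absurd h.2 hv
    · exact absurd h.1 hu
  have himg : (univ.erase (h k)).image π = univ := by
    refine eq_univ_of_forall fun w => ?_
    obtain ⟨v, rfl⟩ := hs w
    rw [mem_image]
    by_cases hv : v = h k
    · exact ⟨t k, by simpa using hk, (hπ _ _).2 (.inr (.inl ⟨rfl, hv⟩))⟩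
    · exact ⟨v, by simpa using hv, rfl⟩
  have h1 := card_image_of_injOn hinj
  rw [himg, card_univ] at h1
  have h2 := card_erase_add_one (mem_univ (h k))
  rw [card_univ] at h2
  omega

theorem isTree_comp_iff [DecidableEq E] [Fintype V] [Fintype V'] (hs : Function.Surjective π)
    (hπ : ∀ u v, π u = π v ↔ u = v ∨ (u = t k ∧ v = h k) ∨ (u = h k ∧ v = t k))
    (hk : t k ≠ h k) {X : Finset E} (hX : k ∉ X) :
    IsTree (π ∘ t) (π ∘ h) X ↔ IsTree t h (insert k X) := by
  have := card_add_one_eq_of_contraction hs hπ hk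
  rw [IsTree, IsTree, spans_comp_iff hs hπ, card_insert_of_notMem hX]
  refine and_congr_right fun _ => ?_
  omega

end Contraction

/-! ### Common trees, separations and the splitting of `S`. -/

/-- For some edge `k` of `S` and some division of the other edges of `S` into two pairs, no set of
edges outside `S` completes both pairs to spanning trees of the graph with `k` deleted or
contracted. -/
def LacksCommonTree {V E : Type*} [Fintype V] [DecidableEq E] (t h : E → V) (S : Finset E) : Prop :=
  ∃ k ∈ S, ∃ A B : Finset E, A ∪ B = S.erase k ∧ Disjoint A B ∧ #A = 2 ∧ #B = 2 ∧
    ((∀ T, Disjoint T S → ¬ (IsTree t h (T ∪ A) ∧ IsTree t h (T ∪ B))) ∨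
      (∀ T, Disjoint T S → ¬ (IsTree t h (insert k (T ∪ A)) ∧ IsTree t h (insert k (T ∪ B)))))

/-- Missing common trees are matched with separations of the deletion or the contraction. The edge
`k` may change on the way: when `k` is a bridge to be deleted or a loop to be contracted, a
different edge of `S` may serve. -/
theorem lacksCommonTree_iff {V E : Type*} [Fintype V] [Fintype E] [DecidableEq V] [DecidableEq E]
    {t h : E → V} {S : Finset E} (hG : Spans t h univ) (hS : #S = 5) {V' : E → Type*}
    [∀ k, Fintype (V' k)] [∀ k, DecidableEq (V' k)] (π : ∀ k, V → V' k)
    (hs : ∀ k, Function.Surjective (π k))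
    (hπ : ∀ k u v, π k u = π k v ↔ u = v ∨ (u = t k ∧ v = h k) ∨ (u = h k ∧ v = t k)) :
    LacksCommonTree t h S ↔ ∃ k ∈ S, Separated t h (univ.erase k) (S.erase k) ∨
      Separated (π k ∘ t) (π k ∘ h) (univ.erase k) (S.erase k) := by
  have hcard : ∀ k ∈ S, #(S.erase k) = 4 := fun k hk => by
    have := card_erase_add_one hk
    omega
  have hsub : ∀ k ∈ S, S.erase k ⊆ univ.erase k := fun k _ => erase_subset_erase _ (subset_univ _)
  have hground : ∀ k ∈ S, Sᶜ ∪ S.erase k = univ.erase k := fun k hk => by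
    ext e
    simp only [mem_union, mem_compl, mem_erase, mem_univ, and_true]
    by_cases he : e = k
    · simp [he, hk]
    · tauto
  have hdis : ∀ k, Disjoint Sᶜ (S.erase k) := fun k =>
    disjoint_compl_left.mono_right (erase_subset _ _)
  have houtside : ∀ k ∈ S, ∀ T, Disjoint T S → T ⊆ univ.erase k \ S.erase k := by
    intro k hk T hT e he
    have heS := Finset.disjoint_left.1 hT he
    exact mem_sdiff.2 ⟨mem_erase.2 ⟨fun h => heS (h ▸ hk), mem_univ e⟩,
      fun h => heS (mem_of_mem_erase h)⟩
  constructor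
  · rintro ⟨k, hk, A, B, hAB, hdAB, hA, hB, hno | hno⟩
    · by_cases hsp : Spans t h (univ.erase k)
      · have := separated_of_forall_not_isTree (F := Sᶜ) hA hB hdAB (by rw [hAB]; exact hdis k)
          (by rwa [hAB, hground k hk])
          (fun T hT => hno T (disjoint_compl_left.mono_left hT))
        rw [hAB, hground k hk] at this
        exact ⟨k, hk, .inl this⟩
      · obtain ⟨e, he, H⟩ := exists_separated_of_not_spans_erase hG (subset_univ S) hS hk hsp
        exact ⟨e, he, .inl H⟩
    · by_cases hloop : t k = h k
      · obtain ⟨e, he⟩ := card_pos.1 (by rw [hcard k hk]; omega : 0 < #(S.erase k))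
        -- After deleting any other edge `e` of `S`, the loop `k` is itself a part with one edge of
        -- `S`, attached at one vertex.
        rw [mem_erase] at he
        exact ⟨e, he.2, .inl (separated_of_loop hloop (mem_erase.2 ⟨he.1.symm, hk⟩)
          (mem_erase.2 ⟨he.1.symm, mem_univ k⟩))⟩
      · have hkT : ∀ T ⊆ Sᶜ, ∀ C ⊆ S.erase k, k ∉ T ∪ C := fun T hT C hC hkTC =>
          (mem_union.1 hkTC).elim (fun h => mem_compl.1 (hT h) hk) fun h => by simpa using hC h
        have := separated_of_forall_not_isTree (t := π k ∘ t) (h := π k ∘ h) (F := Sᶜ) hA hB hdAB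
          (by rw [hAB]; exact hdis k)
          (by
            rw [hAB, hground k hk, spans_comp_iff (hs k) (hπ k)]
            rwa [insert_erase (mem_univ k)])
          (fun T hT => by
            rw [isTree_comp_iff (hs k) (hπ k) hloop (hkT T hT A (hAB ▸ subset_union_left)),
              isTree_comp_iff (hs k) (hπ k) hloop (hkT T hT B (hAB ▸ subset_union_right))]
            exact hno T (disjoint_compl_left.mono_left hT))
        rw [hAB, hground k hk] at this
        exact ⟨k, hk, .inr this⟩
  · rintro ⟨k, hk, H | H⟩
    · obtain ⟨A, B, hAB, hdAB, hA, hB, hno⟩ := H.exists_forall_not_isTree (hsub k hk) (hcard k hk)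
      exact ⟨k, hk, A, B, hAB, hdAB, hA, hB, .inl fun T hT => hno T (houtside k hk T hT)⟩
    · obtain ⟨A, B, hAB, hdAB, hA, hB, hno⟩ := H.exists_forall_not_isTree (hsub k hk) (hcard k hk)
      refine ⟨k, hk, A, B, hAB, hdAB, hA, hB, .inr fun T hT => ?_⟩
      -- A loop lies in no tree, so here the conclusion holds without the separation.
      by_cases hloop : t k = h k
      · rintro ⟨H1, -⟩
        have := H1.card_add_one_le (Y := {k}) (U := {t k}) (by simp) (by simp) (by simp [hloop])
        simp at this
      · have hkT : ∀ C ⊆ S.erase k, k ∉ T ∪ C := fun C hC hkTC =>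
          (mem_union.1 hkTC).elim (fun h => Finset.disjoint_left.1 hT h hk)
            fun h => by simpa using hC h
        rw [← isTree_comp_iff (hs k) (hπ k) hloop (hkT A (hAB ▸ subset_union_left)),
          ← isTree_comp_iff (hs k) (hπ k) hloop (hkT B (hAB ▸ subset_union_right))]
        exact hno T (houtside k hk T hT)

-- The shapes `2, 2, 1` give the contraction alternative with `A = I`, `B = J`, `K = {k}`; the
-- shapes `3, 3, 0` give the deletion alternative with `A = I \ J`, `B = J \ I`, `I ∩ J = {k}`.
open Classical in
theorem splits_iff_lacksCommonTree {α β : Type*} {G : Graph α β} [Fintype V(G)] [Fintype E(G)]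
    (o : Orientation G) (r : V(G)) {S : Set β} (hS : S ⊆ E(G)) :
    Splits o r S ↔ LacksCommonTree o.tail o.head {e : E(G) | (e : β) ∈ S} := by
  let φ : Set β → Finset E(G) := fun X => {e : E(G) | (e : β) ∈ X}
  have mem_φ : ∀ X (e : E(G)), e ∈ φ X ↔ (e : β) ∈ X := fun X e => by simp [φ]
  let ψ : Finset E(G) → Set β := fun X => (fun e : E(G) => (e : β)) '' X
  have mem_ψ : ∀ X (e : E(G)), (e : β) ∈ ψ X ↔ e ∈ X := fun X e => by simp [ψ]
  have φψ : ∀ X, φ (ψ X) = X := fun X => by ext e; rw [mem_φ, mem_ψ]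
  have ψ_card : ∀ X, (ψ X).encard = #X := fun X => by
    rw [Subtype.val_injective.encard_image, Set.encard_coe_eq_coe_finsetCard]
  have ψφ : ∀ X ⊆ E(G), ψ (φ X) = X := fun X hX => by
    ext b
    constructor
    · rintro ⟨e, he, rfl⟩
      exact (mem_φ X e).1 he
    · intro hb
      exact ⟨⟨b, hX hb⟩, (mem_φ X _).2 hb, rfl⟩
  have φ_card : ∀ X ⊆ E(G), (#(φ X) : ℕ∞) = X.encard := fun X hX => by rw [← ψ_card, ψφ X hX]
  have φ_disj : ∀ X Y, Disjoint X Y → Disjoint (φ X) (φ Y) := fun X Y h =>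
    Finset.disjoint_left.2 fun e h1 h2 =>
      Set.disjoint_left.1 h ((mem_φ X e).1 h1) ((mem_φ Y e).1 h2)
  have ψ_disj : ∀ X Y, Disjoint X Y → Disjoint (ψ X) (ψ Y) := fun X Y h =>
    Set.disjoint_image_of_injective Subtype.val_injective (by exact_mod_cast h)
  have φ_union : ∀ X Y, φ (X ∪ Y) = φ X ∪ φ Y := fun X Y => by
    ext e; simp only [mem_φ, mem_union, Set.mem_union]
  have ψ_union : ∀ X Y, ψ (X ∪ Y) = ψ X ∪ ψ Y := fun X Y => by
    simp only [ψ, coe_union, Set.image_union]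
  have equiv : ∀ X Y : Finset E(G),
      #X = #Y → Nonempty (Remaining r (ψ X) ≃ Remaining r (ψ Y)) := by
    intro X Y hXY
    have : Fintype.card {e : E(G) // (e : β) ∉ ψ X} = Fintype.card {e : E(G) // (e : β) ∉ ψ Y} := by
      rw [Fintype.card_subtype_compl, Fintype.card_subtype_compl]
      simp only [mem_ψ, Fintype.card_coe, hXY]
    exact ⟨Equiv.sumCongr (Fintype.equivOfCardEq this) (Equiv.refl _)⟩
  change _ ↔ LacksCommonTree o.tail o.head (φ S)
  constructor
  · rintro ⟨I, J, K, ⟨hIJK, hIK, hJK, hc⟩, σ, hσ⟩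
    have sI : I ⊆ E(G) := (Set.subset_union_left.trans Set.subset_union_left).trans
      (hIJK.subset.trans hS)
    have sJ : J ⊆ E(G) := (Set.subset_union_right.trans Set.subset_union_left).trans
      (hIJK.subset.trans hS)
    have sK : K ⊆ E(G) := Set.subset_union_right.trans (hIJK.subset.trans hS)
    have hU : φ I ∪ φ J ∪ φ K = φ S := by rw [← φ_union, ← φ_union, hIJK]
    have hIJ : #(φ I) = #(φ J) := by
      have : I.encard = J.encard := by
        rcases hc with hc | hc
        · rw [hc.1, hc.2.1]
        · rw [hc.1, hc.2.1]
      rw [← φ_card I sI, ← φ_card J sJ] at this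
      exact_mod_cast this
    have key := (dodgson_ne_zero_iff o r σ (mem_φ I) (mem_φ J) (mem_φ K) (φ_disj _ _ hIK)
      (φ_disj _ _ hJK) hIJ).not
    rw [ne_eq, not_not, hU] at key
    have key := key.1 hσ
    push Not at key
    rcases hc with ⟨cI, cJ, cK, dIJ⟩ | ⟨cI, cJ, rfl, cIJ⟩
    · rw [← φ_card I sI] at cI
      rw [← φ_card J sJ] at cJ
      rw [← φ_card K sK] at cK
      obtain ⟨k, hk⟩ := card_eq_one.1 (by exact_mod_cast cK : #(φ K) = 1)
      have dIJ' := φ_disj _ _ dIJ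
      have dIK := φ_disj _ _ hIK
      have dJK := φ_disj _ _ hJK
      rw [hk] at hU dIK dJK key
      rw [disjoint_singleton_right] at dIK dJK
      refine ⟨k, ?_, φ I, φ J, ?_, dIJ', by exact_mod_cast cI, by exact_mod_cast cJ,
        .inr fun T hT ⟨h1, h2⟩ => key T hT ?_ ?_⟩
      · rw [← hU]; simp
      · rw [← hU, union_comm _ {k}, ← insert_eq, erase_insert]
        simp [dIK, dJK]
      · rw [sdiff_eq_self_of_disjoint dIJ'.symm, ← union_assoc, union_comm _ {k}, ← insert_eq]
        exact h2
      · rw [sdiff_eq_self_of_disjoint dIJ', ← union_assoc, union_comm _ {k}, ← insert_eq]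
        exact h1
    · have φ0 : φ ∅ = ∅ := by simp [φ]
      have φI : φ I ∩ φ J = φ (I ∩ J) := by
        ext e; simp only [mem_φ, mem_inter, Set.mem_inter_iff]
      rw [φ0, union_empty] at hU
      simp only [φ0, union_empty] at key
      rw [← φ_card I sI] at cI
      rw [← φ_card J sJ] at cJ
      rw [← φ_card _ (Set.inter_subset_left.trans sI), ← φI] at cIJ
      obtain ⟨k, hk⟩ := card_eq_one.1 (by exact_mod_cast cIJ : #(φ I ∩ φ J) = 1)
      have cI : #(φ I) = 3 := by exact_mod_cast cI
      have cJ : #(φ J) = 3 := by exact_mod_cast cJ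
      have e1 := card_sdiff_add_card_inter (φ I) (φ J)
      have e2 := card_sdiff_add_card_inter (φ J) (φ I)
      rw [inter_comm (φ J)] at e2
      rw [hk, card_singleton] at e1 e2
      have hmem : ∀ e, e ∈ φ I ∧ e ∈ φ J ↔ e = k := fun e => by
        rw [← mem_inter, hk, mem_singleton]
      refine ⟨k, ?_, φ I \ φ J, φ J \ φ I, ?_, ?_, by omega, by omega,
        .inl fun T hT ⟨h1, h2⟩ => key T hT h2 h1⟩
      · rw [← hU]
        exact mem_union_left _ ((hmem k).2 rfl).1
      · rw [← hU]
        ext e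
        have := hmem e
        simp only [mem_union, mem_sdiff, mem_erase]
        tauto
      · exact disjoint_sdiff_sdiff
  · rintro ⟨k, hk, A, B, hAB, hdAB, hA, hB, hno⟩
    have hS' : insert k (A ∪ B) = φ S := by rw [hAB, insert_erase hk]
    have hkAB : k ∉ A ∪ B := by rw [hAB]; simp
    rw [mem_union, not_or] at hkAB
    rcases hno with hno | hno
    · have cA := card_insert_of_notMem hkAB.1
      have cB := card_insert_of_notMem hkAB.2
      rw [hA] at cA
      rw [hB] at cB
      have hU : insert k A ∪ insert k B ∪ ∅ = φ S := by
        rw [union_empty, ← hS', insert_union, union_insert, insert_idem]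
      obtain ⟨σ⟩ := equiv (insert k A) (insert k B) (cA.trans cB.symm)
      refine ⟨ψ (insert k A), ψ (insert k B), ∅, ⟨?_, by simp, by simp, .inr ⟨?_, ?_, rfl, ?_⟩⟩,
        σ, ?_⟩
      · rw [Set.union_empty, ← ψ_union, ← union_empty (_ ∪ _), hU, ψφ S hS]
      · rw [ψ_card, cA]; rfl
      · rw [ψ_card, cB]; rfl
      · rw [← Set.image_inter Subtype.val_injective, ← coe_inter, ← insert_inter_distrib,
          disjoint_iff_inter_eq_empty.1 hdAB]
        simp
      · by_contra hne
        rw [← ne_eq, dodgson_ne_zero_iff o r σ (I' := insert k A) (J' := insert k B) (K' := ∅)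
          (fun e => (mem_ψ _ e).symm) (fun e => (mem_ψ _ e).symm) (by simp) (by simp) (by simp)
          (cA.trans cB.symm)] at hne
        obtain ⟨T, hT, h1, h2⟩ := hne
        rw [hU] at hT
        have e1 : insert k B \ insert k A = B := by
          have := Finset.disjoint_left.1 hdAB
          ext e
          simp only [mem_sdiff, mem_insert]
          by_cases he : e = k
          · simp [he, hkAB]
          · simp only [he, false_or]; have := @this e; tauto
        have e2 : insert k A \ insert k B = A := by
          have := Finset.disjoint_left.1 hdAB
          ext e
          simp only [mem_sdiff, mem_insert]
          by_cases he : e = k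
          · simp [he, hkAB]
          · simp only [he, false_or]; have := @this e; tauto
        rw [e1, union_empty] at h1
        rw [e2, union_empty] at h2
        exact hno T hT ⟨h2, h1⟩
    · have hU : A ∪ B ∪ {k} = φ S := by
        rw [← hS', union_comm _ {k}, ← insert_eq]
      have dA : Disjoint A {k} := by simpa using hkAB.1
      have dB : Disjoint B {k} := by simpa using hkAB.2
      obtain ⟨σ⟩ := equiv A B (hA.trans hB.symm)
      refine ⟨ψ A, ψ B, ψ {k}, ⟨?_, ψ_disj _ _ dA, ψ_disj _ _ dB,
        .inl ⟨?_, ?_, ?_, ψ_disj _ _ hdAB⟩⟩, σ, ?_⟩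
      · rw [← ψ_union, ← ψ_union, hU, ψφ S hS]
      · rw [ψ_card, hA]; rfl
      · rw [ψ_card, hB]; rfl
      · rw [ψ_card, card_singleton]; rfl
      · by_contra hne
        rw [← ne_eq, dodgson_ne_zero_iff o r σ (I' := A) (J' := B) (K' := {k})
          (fun e => (mem_ψ _ e).symm) (fun e => (mem_ψ _ e).symm) (fun e => (mem_ψ _ e).symm) dA dB
          (hA.trans hB.symm)] at hne
        obtain ⟨T, hT, h1, h2⟩ := hne
        rw [hU] at hT
        rw [sdiff_eq_self_of_disjoint hdAB.symm, ← union_assoc, union_comm _ {k},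
          ← insert_eq] at h1
        rw [sdiff_eq_self_of_disjoint hdAB, ← union_assoc, union_comm _ {k}, ← insert_eq] at h2
        exact hno T hT ⟨h2, h1⟩

/-! ### Decompositions of a graph as separations of finite sets. -/

section Decomposition

variable {α β : Type*}

/-- The subgraph with given sets of vertices and edges. -/
def subgraphOfSets (H : Graph α β) (U : Set α) (X : Set β) (hX : X ⊆ E(H))
    (hU : ∀ e ∈ X, ∀ x y, H.IsLink e x y → x ∈ U) : Graph α β where
  vertexSet := U
  edgeSet := X
  IsLink e x y := H.IsLink e x y ∧ e ∈ X
  isLink_symm _ _ := ⟨fun _ _ h => ⟨h.1.symm, h.2⟩⟩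
  eq_or_eq_of_isLink_of_isLink _ _ _ _ _ h h' := h.1.left_eq_or_eq h'.1
  edge_mem_iff_exists_isLink e := by
    constructor
    · intro he
      obtain ⟨x, y, h⟩ := H.exists_isLink_of_mem_edgeSet (hX he)
      exact ⟨x, y, h, he⟩
    · rintro ⟨x, y, h⟩
      exact h.2
  left_mem_of_isLink e x y h := hU e h.2 x y h.1

-- The embeddings `ν` and `ε` let a single statement serve `G \ e` and `G / e`, whose vertex types
-- differ.
open Classical in
theorem hasSplittingDecomposition_iff {V E : Type*} [Fintype V] {H : Graph α β} {ν : V → α}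
    (hν : Function.Injective ν) (hV : Set.range ν = V(H)) {ε : E → β}
    (hε : Function.Injective ε) {t h : E → V} {D : Finset E}
    (hD : ∀ b, b ∈ E(H) ↔ ∃ e ∈ D, ε e = b)
    (hlink : ∀ e ∈ D, H.IsLink (ε e) (ν (t e)) (ν (h e))) {S : Set β} {S' : Finset E}
    (hS : ∀ e ∈ D, e ∈ S' ↔ ε e ∈ S) :
    HasSplittingDecomposition H S ↔ Separated t h D S' := by
  have card_ν : ∀ W : Finset V, (ν '' W).encard = #W := fun W => by
    rw [hν.encard_image, Set.encard_coe_eq_coe_finsetCard]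
  have card_ε : ∀ X : Finset E, (ε '' X).encard = #X := fun X => by
    rw [hε.encard_image, Set.encard_coe_eq_coe_finsetCard]
  constructor
  · rintro ⟨G₁, G₂, ⟨le₁, le₂, hVV, hEE, -⟩, hc⟩
    let X : Finset E := {e ∈ D | ε e ∈ E(G₁)}
    let U₁ : Finset V := {v | ν v ∈ V(G₁)}
    let U₂ : Finset V := {v | ν v ∈ V(G₂)}
    have mU₁ : ∀ v, v ∈ U₁ ↔ ν v ∈ V(G₁) := fun v => by simp [U₁]
    have mU₂ : ∀ v, v ∈ U₂ ↔ ν v ∈ V(G₂) := fun v => by simp [U₂]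
    have hcU : (V(G₁) ∩ V(G₂)).encard = #(U₁ ∩ U₂) := by
      rw [← card_ν]
      congr 1
      ext x
      constructor
      · rintro ⟨h1, h2⟩
        obtain ⟨v, rfl⟩ : x ∈ Set.range ν := hV ▸ le₁.vertexSet_mono h1
        exact ⟨v, mem_inter.2 ⟨(mU₁ v).2 h1, (mU₂ v).2 h2⟩, rfl⟩
      · rintro ⟨v, hv, rfl⟩
        have hv := mem_inter.1 (mem_coe.1 hv)
        exact ⟨(mU₁ v).1 hv.1, (mU₂ v).1 hv.2⟩
    have hcX : (E(G₁) ∩ S).encard = #(X ∩ S') := by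
      rw [← card_ε]
      congr 1
      ext b
      constructor
      · rintro ⟨h1, h2⟩
        obtain ⟨e, he, rfl⟩ := (hD b).1 (le₁.edgeSet_mono h1)
        exact ⟨e, mem_inter.2 ⟨mem_filter.2 ⟨he, h1⟩, (hS e he).2 h2⟩, rfl⟩
      · rintro ⟨e, he, rfl⟩
        have he := mem_inter.1 (mem_coe.1 he)
        have he1 := mem_filter.1 he.1
        exact ⟨he1.2, (hS e he1.1).1 he.2⟩
    rw [hcU, hcX] at hc
    refine ⟨X, U₁, U₂, filter_subset _ _, ?_, ?_, ?_, by exact_mod_cast hc⟩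
    · refine eq_univ_of_forall fun v => ?_
      rw [mem_union, mU₁, mU₂, ← Set.mem_union, hVV, ← hV]
      exact Set.mem_range_self v
    · intro e he
      have he := mem_filter.1 he
      have hl := (le₁.isLink_iff he.2).2 (hlink e he.1)
      exact ⟨(mU₁ _).2 hl.left_mem, (mU₁ _).2 hl.right_mem⟩
    · intro e he heX
      have he2 : ε e ∈ E(G₂) := by
        have : ε e ∈ E(G₁) ∪ E(G₂) := hEE ▸ (hD _).2 ⟨e, he, rfl⟩
        exact this.resolve_left fun h1 => heX (mem_filter.2 ⟨he, h1⟩)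
      have hl := (le₂.isLink_iff he2).2 (hlink e he)
      exact ⟨(mU₂ _).2 hl.left_mem, (mU₂ _).2 hl.right_mem⟩
  · rintro ⟨X, U₁, U₂, hXD, hU, h₁, h₂, hc⟩
    have sub : ∀ Y ⊆ D, ε '' Y ⊆ E(H) := by
      rintro Y hY _ ⟨e, he, rfl⟩
      exact (hD _).2 ⟨e, hY he, rfl⟩
    have ends : ∀ Y ⊆ D, ∀ W : Finset V, (∀ e ∈ Y, t e ∈ W ∧ h e ∈ W) →
        ∀ b ∈ ε '' (Y : Set E), ∀ x y, H.IsLink b x y → x ∈ ν '' (W : Set V) := by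
      rintro Y hY W hW _ ⟨e, he, rfl⟩ x y hxy
      rcases hxy.left_eq_or_eq (hlink e (hY he)) with rfl | rfl
      · exact ⟨_, (hW e he).1, rfl⟩
      · exact ⟨_, (hW e he).2, rfl⟩
    have hsd : ∀ e ∈ D \ X, t e ∈ U₂ ∧ h e ∈ U₂ := fun e he =>
      h₂ e (mem_sdiff.1 he).1 (mem_sdiff.1 he).2
    have hVsub : ∀ W : Finset V, ν '' (W : Set V) ⊆ V(H) := fun W => by
      rw [← hV]; exact Set.image_subset_range _ _
    refine ⟨subgraphOfSets H (ν '' U₁) (ε '' X) (sub X hXD) (ends X hXD U₁ h₁),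
      subgraphOfSets H (ν '' U₂) (ε '' (D \ X : Finset E)) (sub _ sdiff_subset)
        (ends _ sdiff_subset U₂ hsd),
      ⟨⟨hVsub _, fun _ _ _ h => h.1⟩, ⟨hVsub _, fun _ _ _ h => h.1⟩, ?_, ?_, ?_⟩, ?_⟩
    · change ν '' U₁ ∪ ν '' U₂ = _
      rw [← Set.image_union, ← coe_union, hU, coe_univ, Set.image_univ, hV]
    · change ε '' X ∪ ε '' (D \ X : Finset E) = _
      rw [← Set.image_union, ← coe_union, union_sdiff_of_subset hXD]
      ext b
      exact (hD b).symm
    · change Disjoint (ε '' X) (ε '' (D \ X : Finset E))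
      exact Set.disjoint_image_of_injective hε (by exact_mod_cast disjoint_sdiff)
    · have hcU : (ν '' (U₁ : Set V) ∩ ν '' (U₂ : Set V)).encard = #(U₁ ∩ U₂) := by
        rw [← Set.image_inter hν, ← coe_inter, card_ν]
      have hcX : (ε '' (X : Set E) ∩ S).encard = #(X ∩ S') := by
        rw [← card_ε]
        congr 1
        ext b
        constructor
        · rintro ⟨⟨e, he, rfl⟩, hb⟩
          exact ⟨e, mem_inter.2 ⟨he, (hS e (hXD he)).2 hb⟩, rfl⟩
        · rintro ⟨e, he, rfl⟩
          have he := mem_inter.1 (mem_coe.1 he)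
          exact ⟨⟨e, he.1, rfl⟩, (hS e (hXD he.1)).1 he.2⟩
      change ((ν '' (U₁ : Set V) ∩ ν '' (U₂ : Set V)).encard ≤ 2 ∧
        (ε '' (X : Set E) ∩ S).encard = 2) ∨ ((ν '' (U₁ : Set V) ∩ ν '' (U₂ : Set V)).encard = 1 ∧
        (ε '' (X : Set E) ∩ S).encard = 1)
      rw [hcU, hcX]
      exact_mod_cast hc

end Decomposition

/-! ### Deletion and contraction in `Graph`. -/

section Graph

variable {α β : Type*} {G : Graph α β}

theorem Connected.spans [Fintype E(G)] (hG : Connected G) (o : Orientation G) :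
    Spans o.tail o.head univ := by
  classical
  intro f hf u v
  let F : α → ℚ := fun x => if hx : x ∈ V(G) then f ⟨x, hx⟩ else 0
  have hF : ∀ v : V(G), F v = f v := fun v => dif_pos v.2
  have hadj : ∀ x y, G.Adj x y → F x = F y := by
    rintro x y ⟨e, he⟩
    have h := o.isLink ⟨e, he.edge_mem⟩
    have hfe := hf ⟨e, he.edge_mem⟩ (mem_univ _)
    rw [← hF, ← hF] at hfe
    rcases he.eq_and_eq_or_eq_and_eq h with ⟨hx, hy⟩ | ⟨hx, hy⟩
    · exact (congrArg F hx).trans (hfe.trans (congrArg F hy).symm)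
    · exact (congrArg F hx).trans (hfe.symm.trans (congrArg F hy).symm)
  have hreach : ∀ x y, Relation.ReflTransGen G.Adj x y → F x = F y := by
    intro x y hxy
    induction hxy with
    | refl => rfl
    | tail _ h ih => exact ih.trans (hadj _ _ h)
  rw [← hF, ← hF, hreach u v (hG.2 u u.2 v v.2)]

/-- An edge has only two ends, so closing `IsLink k` under transitivity adds nothing but
reflexivity. -/
theorem quot_mk_isLink_eq_iff {k : β} {x y : α} :
    Quot.mk (G.IsLink k) x = Quot.mk (G.IsLink k) y ↔ x = y ∨ G.IsLink k x y := by
  constructor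
  · intro hxy
    have hgen := Quot.eqvGen_exact hxy
    clear hxy
    induction hgen with
    | rel x y h => exact .inr h
    | refl x => exact .inl rfl
    | symm x y _ ih => exact ih.imp Eq.symm Graph.IsLink.symm
    | trans x y z _ _ ih ih' =>
      rcases ih with rfl | ih
      · exact ih'
      rcases ih' with rfl | ih'
      · exact .inr ih
      rcases ih.left_eq_or_eq ih' with rfl | rfl
      · exact .inr ih'
      · exact .inl rfl
  · rintro (rfl | h)
    · rfl
    · exact Quot.sound h

/-- The map from the vertices of `G` to those of `G / k`. -/
def contractVertex (G : Graph α β) (k : β) (v : V(G)) : V(contract G k) :=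
  ⟨Quot.mk _ v, v, v.2, rfl⟩

theorem contractVertex_surjective (k : β) : Function.Surjective (contractVertex G k) := by
  rintro ⟨_, v, hv, rfl⟩
  exact ⟨⟨v, hv⟩, rfl⟩

theorem contractVertex_eq_iff (o : Orientation G) (k : E(G)) (u v : V(G)) :
    contractVertex G k u = contractVertex G k v ↔
      u = v ∨ (u = o.tail k ∧ v = o.head k) ∨ (u = o.head k ∧ v = o.tail k) := by
  have h1 : contractVertex G k u = contractVertex G k v ↔
      Quot.mk (G.IsLink k) (u : α) = Quot.mk (G.IsLink k) (v : α) := Subtype.ext_iff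
  rw [h1, quot_mk_isLink_eq_iff, Subtype.ext_iff, Subtype.ext_iff, Subtype.ext_iff, Subtype.ext_iff,
    Subtype.ext_iff]
  refine or_congr_right ⟨fun h => h.eq_and_eq_or_eq_and_eq (o.isLink k), ?_⟩
  rintro (⟨hu, hv⟩ | ⟨hu, hv⟩)
  · rw [hu, hv]; exact o.isLink k
  · rw [hu, hv]; exact (o.isLink k).symm

theorem mem_edgeSet_delete_iff [Fintype E(G)] [DecidableEq E(G)] (k : E(G)) (b : β) :
    b ∈ E(delete G k) ↔ ∃ e ∈ (univ : Finset E(G)).erase k, (e : β) = b := by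
  have h1 : b ∈ E(delete G k) ↔ b ∈ E(G) ∧ b ≠ k := Iff.rfl
  rw [h1]
  constructor
  · rintro ⟨hb, hbk⟩
    exact ⟨⟨b, hb⟩, mem_erase.2 ⟨fun h => hbk (congrArg Subtype.val h), mem_univ _⟩, rfl⟩
  · rintro ⟨e, he, rfl⟩
    exact ⟨e.2, fun h => ne_of_mem_erase he (Subtype.ext h)⟩

theorem hasSplittingDecomposition_delete_iff [Fintype V(G)] [Fintype E(G)] [DecidableEq V(G)]
    [DecidableEq E(G)] (o : Orientation G) (k : E(G)) {S : Set β} {S' : Finset E(G)}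
    (hS : ∀ e : E(G), e ∈ S' ↔ (e : β) ∈ S) :
    HasSplittingDecomposition (delete G k) S ↔
      Separated o.tail o.head (univ.erase k) (S'.erase k) := by
  convert hasSplittingDecomposition_iff (H := delete G k) (ν := fun v : V(G) => (v : α))
    Subtype.val_injective Subtype.range_val (ε := fun e : E(G) => (e : β)) Subtype.val_injective
    (mem_edgeSet_delete_iff k) ?_ ?_
  · intro e he
    have : (e : β) ≠ k := fun h => ne_of_mem_erase he (Subtype.ext h)
    exact ⟨o.isLink e, by simpa using this⟩
  · intro e he
    rw [mem_erase, hS]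
    simp [ne_of_mem_erase he]

theorem hasSplittingDecomposition_contract_iff [Fintype E(G)] [DecidableEq E(G)]
    (o : Orientation G) (k : E(G)) [Fintype V(contract G k)] [DecidableEq V(contract G k)]
    {S : Set β} {S' : Finset E(G)} (hS : ∀ e : E(G), e ∈ S' ↔ (e : β) ∈ S) :
    HasSplittingDecomposition (contract G k) S ↔
      Separated (contractVertex G k ∘ o.tail) (contractVertex G k ∘ o.head) (univ.erase k)
        (S'.erase k) := by
  convert hasSplittingDecomposition_iff (H := contract G k)
    (ν := fun v : V(contract G k) => (v : Quot (G.IsLink k)))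
    Subtype.val_injective Subtype.range_val (ε := fun e : E(G) => (e : β)) Subtype.val_injective
    (mem_edgeSet_delete_iff k) ?_ ?_
  · intro e he
    have : (e : β) ≠ k := fun h => ne_of_mem_erase he (Subtype.ext h)
    exact ⟨_, _, ⟨o.isLink e, by simpa using this⟩, rfl, rfl⟩
  · intro e he
    rw [mem_erase, hS]
    simp [ne_of_mem_erase he]

end Graph

end FeynmanSplit

theorem mainTheorem6 {α β : Type*} (G : Graph α β) [Finite V(G)] [Finite E(G)]
    (hG : FeynmanSplit.Connected G) (o : FeynmanSplit.Orientation G) (r : V(G))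
    (S : Set β) (hS : FeynmanSplit.IsFiveConfiguration G S) :
    FeynmanSplit.Splits o r S ↔
      ∃ e ∈ S, FeynmanSplit.HasSplittingDecomposition (FeynmanSplit.delete G e) S ∨
        FeynmanSplit.HasSplittingDecomposition (FeynmanSplit.contract G e) S := by
  classical
  have := Fintype.ofFinite V(G)
  have := Fintype.ofFinite E(G)
  have (k : E(G)) : Fintype V(FeynmanSplit.contract G k) :=
    Fintype.ofSurjective _ (FeynmanSplit.contractVertex_surjective (G := G) (k : β))
  let S' : Finset E(G) := {e : E(G) | (e : β) ∈ S}
  have hS' : ∀ e : E(G), e ∈ S' ↔ (e : β) ∈ S := fun e => by simp [S']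
  have hcard : S'.card = 5 := by
    have h1 : (fun e : E(G) => (e : β)) '' S' = S := by
      ext b
      constructor
      · rintro ⟨e, he, rfl⟩
        exact (hS' e).1 he
      · intro hb
        exact ⟨⟨b, hS.1 hb⟩, (hS' _).2 hb, rfl⟩
    have h2 := hS.2
    rw [← h1, Subtype.val_injective.encard_image, Set.encard_coe_eq_coe_finsetCard] at h2
    exact_mod_cast h2
  rw [FeynmanSplit.splits_iff_lacksCommonTree o r hS.1]
  refine (FeynmanSplit.lacksCommonTree_iff (hG.spans o) hcard
    (fun k : E(G) => FeynmanSplit.contractVertex G (k : β))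
    (fun k => FeynmanSplit.contractVertex_surjective (k : β))
    (FeynmanSplit.contractVertex_eq_iff o)).trans ?_
  constructor
  · rintro ⟨k, hk, H⟩
    refine ⟨k, (hS' k).1 hk, H.imp (fun H => ?_) fun H => ?_⟩
    · exact (FeynmanSplit.hasSplittingDecomposition_delete_iff o k hS').2 H
    · exact (FeynmanSplit.hasSplittingDecomposition_contract_iff o k hS').2 H
  · rintro ⟨k, hk, H⟩
    refine ⟨⟨k, hS.1 hk⟩, (hS' _).2 hk, H.imp (fun H => ?_) fun H => ?_⟩
    · exact (FeynmanSplit.hasSplittingDecomposition_delete_iff o ⟨k, hS.1 hk⟩ hS').1 H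
    · exact (FeynmanSplit.hasSplittingDecomposition_contract_iff o ⟨k, hS.1 hk⟩ hS').1 H
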